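/- Let $H$ be a real Hilbert space, let $U_1,U_2:H\rightrightarrows H$ be maximal monotone operators and $c>0$. For an operator $\mathsf T$ write $J_{\mathsf T}=(\mathrm{Id}+\mathsf T)^{-1}$, $R_{\mathsf T}=2J_{\mathsf T}-\mathrm{Id}$, $zer(\mathsf T)=\{x:0\in \mathsf T(x)\}$. Let $(\alpha_n)\subset[0,1]$, $(\beta_n)\subset[-1,1]$, $x_0,u\in H$, and let $(x_n),(y_n),(z_n)$ be generated by $$x_{2n+1}=(1-\alpha_n)x_{2n}+\alpha_nu,\quad y_n=J_{cU_2}(x_{2n+1}),\quad z_n=J_{cU_1}(2y_n-x_{2n+1}),\quad x_{2n+2}=x_{2n+1}+(1-\beta_n)(z_n-y_n).$$ Let $\Gamma_1,\Gamma_3,\Gamma_4:(0,+\infty)\to\mathbb N$ be nonincreasing and $\Gamma_2:\mathbb N\to\mathbb N$ nondecreasing functions such that for all $\varepsilon>0$ and $n,k\in\mathbb N$: $\alpha_m\le\varepsilon$ for all $m\ge\Gamma_1(\varepsilon)$; $\sum_{i=0}^{\Gamma_2(k)}\alpha_i\ge k$; $\sum_{i=\Gamma_3(\varepsilon)+1}^{\Gamma_3(\varepsilon)+n}|\alpha_{i+1}-\alpha_i|\le\varepsilon$;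 $\sum_{i=\Gamma_4(\varepsilon)+1}^{\Gamma_4(\varepsilon)+n}|\beta_{i+1}-\beta_i|\le\varepsilon$. Assume that $N\in\mathbb N\setminus\{0\}$ satisfies $N\ge\max\{\|x_0-p\|,2\|u-p\|\}$ for some $p\in\mathrm{Fix}(R_{cU_1}\circ R_{cU_2})$, and that $\gamma\in(0,1]$ satisfies $-1+\gamma\le\beta_n\le1-\gamma$ for all $n$. A function $M:(0,+\infty)\times\mathbb N^{\mathbb N}\to\mathbb N$ is a rate of metastability for a sequence $(w_n)$ if for all $\varepsilon>0$ and $f:\mathbb N\to\mathbb N$ there is $n\le M(\varepsilon,f)$ with $\|w_i-w_j\|\le\varepsilon$ for all $i,j\in[n,f(n)]$. Then: (i) $(x_n)$ converges strongly to $\overline x=P_{\mathrm{Fix}(R_{cU_1}\circ R_{cU_2})}(u)$, the unique point of $\mathrm{Fix}(R_{cU_1}\circ R_{cU_2})$ nearest to $u$, and $\mu_3:=\mu[N,\gamma/2,\Gamma_1,\Gamma_2,\Gamma_3,\Gamma_4]$ is a rate of metastability for $(x_n)$; (ii) $(y_n)$ and $(z_n)$ converge strongly to $J_{cU_2}(\overline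 x)\in zer(U_1+U_2)$, and $(\varepsilon,f)\mapsto\mu_3(\varepsilon,2f+1)$ and $(\varepsilon,f)\mapsto\mu_3(\varepsilon/3,2f+1)$ are rates of metastability for $(y_n)$ and $(z_n)$, respectively. Here, for $\gamma'>0$, the functional $\mu=\mu[N,\gamma',\Gamma_1,\Gamma_2,\Gamma_3,\Gamma_4]$ is defined as follows, where $\lceil x\rceil$ denotes the least natural number $\geq x$ (so $0$ if $x\leq 0$): - $\theta_1(\varepsilon)=\Gamma_2\big(\max\{\Gamma_3(\tfrac{\varepsilon}{8N}),\Gamma_4(\tfrac{\varepsilon}{8N})\}+\lceil\ln\tfrac{4N}{\varepsilon}\rceil+2\big)+1$, - $\theta_3(\varepsilon)=\max\{\theta_1(\tfrac{(\gamma'\varepsilon)^2}{8N}),\Gamma_1(\tfrac{(\gamma'\varepsilon)^2}{2N^2})\}$, $\quad\theta_4(\varepsilon)=\max\{\theta_1(\tfrac\varepsilon2),\theta_3(\tfrac\varepsilon2)\}$, - $\rho_2(\varepsilon)=2\theta_3(\tfrac\varepsilon3)+2$, $\quad\rho_3(\varepsilon)=2\max\{\theta_4(\tfrac\varepsilon6),\Gamma_1(\tfrac{\varepsilon}{4N})\}+1$,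 $\quad\rho=\max\{\rho_2,\rho_3\}$, - $\varphi(\varepsilon,\delta)=\min\{\delta^{(i)}(1):0\le i\le\lceil\tfrac{N^2}{4\varepsilon}\rceil\}$ for $\delta:(0,1]\to(0,1]$, where $\delta^{(i)}$ is the $i$-th iterate of $\delta$, - $\Phi(\varepsilon,\delta)=\tfrac{1}{24N}\,\varphi\big(\tfrac{\varepsilon^2}{4N^2},\tilde\delta\big)^2$ with $\tilde\delta(\xi)=\min\{\delta(\tfrac{\xi^2}{24N}),\tfrac{\xi^2}{24N}\}$, - $\Psi(\varepsilon,\Delta)=\rho\big(\Phi(\varepsilon,\eta\mapsto\Delta(\rho(\eta)))\big)$ for $\Delta:\mathbb N\to(0,1]$, - and, given $\varepsilon>0$ and $f:\mathbb N\to\mathbb N$, with $\tilde\varepsilon=\tfrac{\varepsilon^2}{16}$: $K(n)=\max\{n,\rho_3(\tfrac{\tilde\varepsilon}{36N})\}$, $\Sigma(n)=\Gamma_2\big(K(n)+\lceil\ln\tfrac{12N^2}{\tilde\varepsilon}\rceil\big)+1$, $P(n)=f\big(2\max\{\Sigma(n),\theta_4(\tfrac\varepsilon4)\}+1\big)$,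 $\Delta_{\varepsilon,f}(n)=\min\{\tfrac{\tilde\varepsilon}{30N(P(n)+1)},1\}$, and $$\mu(\varepsilon,f)=2\max\Big\{\Sigma\big(\Psi(\tfrac{\tilde\varepsilon}{24},\Delta_{\varepsilon,f})\big),\theta_4(\tfrac\varepsilon4)\Big\}+1 .$$ -/

import Mathlib

open Filter Topology

noncomputable section

namespace DouglasRachford

/-! ### Set-valued operators on a real Hilbert space -/

section Operators

variable {H : Type*} [NormedAddCommGroup H] [InnerProductSpace ℝ H]

/-- The graph of a set-valued operator. -/
def graph (A : H → Set H) : Set (H × H) := {q | q.2 ∈ A q.1}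

/-- `A` is monotone: `⟪x - x', y - y'⟫ ≥ 0` for all `(x, y)`, `(x', y')` in the graph. -/
def IsMonotoneOperator (A : H → Set H) : Prop :=
  ∀ q ∈ graph A, ∀ q' ∈ graph A, 0 ≤ inner ℝ (q.1 - q'.1) (q.2 - q'.2)

/-- `A` is maximal monotone: it is monotone and its graph is not properly contained in the
graph of another monotone operator. -/
def IsMaximalMonotoneOperator (A : H → Set H) : Prop :=
  IsMonotoneOperator A ∧
    ∀ B : H → Set H, IsMonotoneOperator B → graph A ⊆ graph B → graph B = graph A

/-- The operator `c A : x ↦ {c • v | v ∈ A x}`. -/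
def scale (c : ℝ) (A : H → Set H) : H → Set H := fun x => {w | ∃ v ∈ A x, w = c • v}

/-- The operator `A + B : x ↦ {a + b | a ∈ A x, b ∈ B x}`. -/
def sum (A B : H → Set H) : H → Set H := fun x => {w | ∃ a ∈ A x, ∃ b ∈ B x, w = a + b}

/-- The set of zeros of a set-valued operator. -/
def zer (A : H → Set H) : Set H := {x | (0 : H) ∈ A x}

/-- The resolvent `J_A = (I + A)⁻¹`: the point `J_A x` is the `y` with `x ∈ y + A y`. For monotone
`A` there is at most one such `y`, for maximal monotone `A` there is exactly one; outside the
range of `I + A` the value is arbitrary. -/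
def resolvent (A : H → Set H) : H → H := fun x => Classical.epsilon fun y => x - y ∈ A y

/-- The reflected resolvent `R_A = 2 J_A - Id`. -/
def reflectedResolvent (A : H → Set H) : H → H := fun x => (2 : ℝ) • resolvent A x - x

end Operators

/-! ### Metric projection, rates -/

/-- `p` is the metric projection of `u` onto `S`: the unique point of `S` nearest to `u`. -/
def IsMetricProjection {X : Type*} [MetricSpace X] (S : Set X) (u p : X) : Prop :=
  p ∈ S ∧ (∀ q ∈ S, dist u p ≤ dist u q) ∧
    ∀ p' ∈ S, (∀ q ∈ S, dist u p' ≤ dist u q) → p' = p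

/-- `g` is a rate of convergence for `lim a n = 0`. Only the values of `g` on `(0, ∞)` matter. -/
def IsRateOfConvergenceToZero (a : ℕ → ℝ) (g : ℝ → ℕ) : Prop :=
  ∀ ε : ℝ, 0 < ε → ∀ n : ℕ, g ε ≤ n → |a n| ≤ ε

/-- `g` is a rate of divergence for the series `∑ a i` (of non-negative terms). -/
def IsRateOfDivergenceOfSum (a : ℕ → ℝ) (g : ℕ → ℕ) : Prop :=
  ∀ k : ℕ, (k : ℝ) ≤ ∑ i ∈ Finset.range (g k + 1), a i

/-- `g` is a Cauchy rate for the series `∑ b i` (of non-negative terms). -/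
def IsCauchyRateOfSum (b : ℕ → ℝ) (g : ℝ → ℕ) : Prop :=
  ∀ ε : ℝ, 0 < ε → ∀ n : ℕ, ∑ i ∈ Finset.Icc (g ε + 1) (g ε + n), b i ≤ ε

/-- `M` is a rate of metastability for the sequence `x`. -/
def IsRateOfMetastability {X : Type*} [MetricSpace X] (x : ℕ → X)
    (M : ℝ → (ℕ → ℕ) → ℕ) : Prop :=
  ∀ ε : ℝ, 0 < ε → ∀ f : ℕ → ℕ, ∃ n ≤ M ε f,
    ∀ i ∈ Set.Icc n (f n), ∀ j ∈ Set.Icc n (f n), dist (x i) (x j) ≤ ε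

/-! ### The explicit rate of metastability `μ[N, γ, Γ₁, Γ₂, Γ₃, Γ₄]`

`⌈x⌉₊` is `max 0 ⌈x⌉`. -/

/-- `σ[A, D](ε, K) = A (K + ⌈ln (3D/ε)⌉) + 1`. -/
def sigmaRate (A : ℕ → ℕ) (D : ℕ) (ε : ℝ) (K : ℕ) : ℕ :=
  A (K + ⌈Real.log (3 * D / ε)⌉₊) + 1

/-- `θ̂[A, V, D](ε) = A (V (ε/2) + ⌈ln (2D/ε)⌉ + 1) + 1`. -/
def thetaHat (A : ℕ → ℕ) (V : ℝ → ℕ) (D : ℕ) (ε : ℝ) : ℕ :=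
  A (V (ε / 2) + ⌈Real.log (2 * D / ε)⌉₊ + 1) + 1

/-- `θ₁ = θ̂[A, V, 2N]` with `A k = Γ₂ (k + 1)` and `V ε = max {Γ₃ (ε/4N), Γ₄ (ε/4N)}`. -/
def theta1 (N : ℕ) (Γ₂ : ℕ → ℕ) (Γ₃ Γ₄ : ℝ → ℕ) (ε : ℝ) : ℕ :=
  thetaHat (fun k => Γ₂ (k + 1)) (fun ε' => max (Γ₃ (ε' / (4 * N))) (Γ₄ (ε' / (4 * N))))
    (2 * N) ε

/-- `θ₃ ε = max {θ₁ ((γε)²/8N), Γ₁ ((γε)²/2N²)}`. -/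
def theta3 (N : ℕ) (γ : ℝ) (Γ₁ : ℝ → ℕ) (Γ₂ : ℕ → ℕ) (Γ₃ Γ₄ : ℝ → ℕ) (ε : ℝ) : ℕ :=
  max (theta1 N Γ₂ Γ₃ Γ₄ ((γ * ε) ^ 2 / (8 * N))) (Γ₁ ((γ * ε) ^ 2 / (2 * N ^ 2)))

/-- `θ₄ ε = max {θ₁ (ε/2), θ₃ (ε/2)}`. -/
def theta4 (N : ℕ) (γ : ℝ) (Γ₁ : ℝ → ℕ) (Γ₂ : ℕ → ℕ) (Γ₃ Γ₄ : ℝ → ℕ) (ε : ℝ) : ℕ :=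
  max (theta1 N Γ₂ Γ₃ Γ₄ (ε / 2)) (theta3 N γ Γ₁ Γ₂ Γ₃ Γ₄ (ε / 2))

/-- `ρ₂ ε = 2 θ₃ (ε/3) + 2`. -/
def rho2 (N : ℕ) (γ : ℝ) (Γ₁ : ℝ → ℕ) (Γ₂ : ℕ → ℕ) (Γ₃ Γ₄ : ℝ → ℕ) (ε : ℝ) : ℕ :=
  2 * theta3 N γ Γ₁ Γ₂ Γ₃ Γ₄ (ε / 3) + 2

/-- `ρ₃ ε = 2 max {θ₄ (ε/6), Γ₁ (ε/4N)} + 1`. -/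
def rho3 (N : ℕ) (γ : ℝ) (Γ₁ : ℝ → ℕ) (Γ₂ : ℕ → ℕ) (Γ₃ Γ₄ : ℝ → ℕ) (ε : ℝ) : ℕ :=
  2 * max (theta4 N γ Γ₁ Γ₂ Γ₃ Γ₄ (ε / 6)) (Γ₁ (ε / (4 * N))) + 1

/-- `ρ = max {ρ₂, ρ₃}`. -/
def rho (N : ℕ) (γ : ℝ) (Γ₁ : ℝ → ℕ) (Γ₂ : ℕ → ℕ) (Γ₃ Γ₄ : ℝ → ℕ) (ε : ℝ) : ℕ :=
  max (rho2 N γ Γ₁ Γ₂ Γ₃ Γ₄ ε) (rho3 N γ Γ₁ Γ₂ Γ₃ Γ₄ ε)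

/-- `φ[N](ε, δ) = min {δ^(i)(1) : i ≤ r}` with `r = ⌈N²/4ε⌉`, for `δ : (0, 1] → (0, 1]`. -/
def phi (N : ℕ) (ε : ℝ) (δ : ℝ → ℝ) : ℝ :=
  (Finset.range (⌈(N : ℝ) ^ 2 / (4 * ε)⌉₊ + 1)).inf' Finset.nonempty_range_add_one
    (fun i => δ^[i] 1)

/-- `Φ[N](ε, δ) = φ(ε̃, δ̃)²/24N` with `ε̃ = ε²/4N²`, `δ̃ ξ = min {δ (ξ²/24N), ξ²/24N}`. -/
def Phi (N : ℕ) (ε : ℝ) (δ : ℝ → ℝ) : ℝ :=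
  phi N (ε ^ 2 / (4 * N ^ 2)) (fun ξ => min (δ (ξ ^ 2 / (24 * N))) (ξ ^ 2 / (24 * N))) ^ 2 /
    (24 * N)

/-- `Ψ[N, ρ](ε, Δ) = ρ (Φ(ε, Δ ∘ ρ))`, for `Δ : ℕ → (0, 1]`. -/
def Psi (N : ℕ) (ρ : ℝ → ℕ) (ε : ℝ) (Δ : ℕ → ℝ) : ℕ :=
  ρ (Phi N ε (fun η => Δ (ρ η)))

/-- `Σ n = σ[Γ₂, 4N²](ε̃, K n)`, `K n = max {n, ρ₃ (ε̃/36N)}`, where `ε̃ = ε²/16`. -/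
def SigmaFun (N : ℕ) (γ : ℝ) (Γ₁ : ℝ → ℕ) (Γ₂ : ℕ → ℕ) (Γ₃ Γ₄ : ℝ → ℕ) (ε : ℝ) (n : ℕ) : ℕ :=
  sigmaRate Γ₂ (4 * N ^ 2) (ε ^ 2 / 16)
    (max n (rho3 N γ Γ₁ Γ₂ Γ₃ Γ₄ (ε ^ 2 / 16 / (36 * N))))

/-- `P n = f (2 max {Σ n, θ₄ (ε/4)} + 1)`. -/
def PFun (N : ℕ) (γ : ℝ) (Γ₁ : ℝ → ℕ) (Γ₂ : ℕ → ℕ) (Γ₃ Γ₄ : ℝ → ℕ) (ε : ℝ) (f : ℕ → ℕ)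
    (n : ℕ) : ℕ :=
  f (2 * max (SigmaFun N γ Γ₁ Γ₂ Γ₃ Γ₄ ε n) (theta4 N γ Γ₁ Γ₂ Γ₃ Γ₄ (ε / 4)) + 1)

/-- `Δ_{ε,f} n = min {ε̃ / (30 N (P n + 1)), 1}`, where `ε̃ = ε²/16`. -/
def DeltaFun (N : ℕ) (γ : ℝ) (Γ₁ : ℝ → ℕ) (Γ₂ : ℕ → ℕ) (Γ₃ Γ₄ : ℝ → ℕ) (ε : ℝ) (f : ℕ → ℕ)
    (n : ℕ) : ℝ :=
  min (ε ^ 2 / 16 / (30 * N * ((PFun N γ Γ₁ Γ₂ Γ₃ Γ₄ ε f n : ℝ) + 1))) 1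

/-- `μ(ε, f) = 2 max {Σ (Ψ(ε̃/24, Δ_{ε,f})), θ₄ (ε/4)} + 1`, where `ε̃ = ε²/16` and
`Ψ = Ψ[N, ρ]`. -/
def mu (N : ℕ) (γ : ℝ) (Γ₁ : ℝ → ℕ) (Γ₂ : ℕ → ℕ) (Γ₃ Γ₄ : ℝ → ℕ) (ε : ℝ) (f : ℕ → ℕ) : ℕ :=
  2 * max
      (SigmaFun N γ Γ₁ Γ₂ Γ₃ Γ₄ ε
        (Psi N (rho N γ Γ₁ Γ₂ Γ₃ Γ₄) (ε ^ 2 / 16 / 24) (DeltaFun N γ Γ₁ Γ₂ Γ₃ Γ₄ ε f)))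
      (theta4 N γ Γ₁ Γ₂ Γ₃ Γ₄ (ε / 4)) + 1

/-- `μ₃[N, γ, Γ₁, Γ₂, Γ₃, Γ₄] = μ[N, γ/2, Γ₁, Γ₂, Γ₃, Γ₄]`. -/
def mu3 (N : ℕ) (γ : ℝ) (Γ₁ : ℝ → ℕ) (Γ₂ : ℕ → ℕ) (Γ₃ Γ₄ : ℝ → ℕ) (ε : ℝ) (f : ℕ → ℕ) : ℕ :=
  mu N (γ / 2) Γ₁ Γ₂ Γ₃ Γ₄ ε f

end DouglasRachford

end

/-!
Write `R = R_{cU₁} ∘ R_{cU₂}`. By Minty's theorem the resolvents are everywhere defined and firmly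
nonexpansive, so `R` is nonexpansive, and since `z_n - y_n = (R v - v) / 2` for `v = x_{2n+1}`, the
sequence `x` alternates Halpern steps towards `u` with Mann steps of `R` of weight
`(1 - β_n) / 2 ∈ [γ/2, 1 - γ/2]` (`IsHalpernMann`). The rest concerns such iterations of an
arbitrary nonexpansive `T` with a fixed point.

Minty's theorem (`IsMaximalMonotoneOperator.exists_sub_mem`) is reduced to a common solution of
quadratic inequalities indexed by the graph. Monotonicity makes an associated quadratic functional
nonnegative on a convex hull, and a minimizing sequence for it converges to a solution.

Asymptotic regularity: successive even iterates satisfy a recursion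
`s (n + 1) ≤ (1 - a n) s n + c n` with `∑ a n = ∞` and `∑ c n < ∞`, so Xu's lemma with rates
(`le_of_weighted_recursion`) gives the rate `θ₁`; strict convexity of the squared norm then gives
the rate `ρ` for the residuals `‖T x_m - x_m‖`.

Metastability: exact projection onto `Fix T` is replaced by a finite descent
(`exists_approx_nearest`) that yields, with an explicit bound, some `η` and a point `z` that is as
good an approximate fixed point as desired relative to `η` and satisfies
`⟪u - z, y - z⟫ ≤ ε` for all bounded `η`-fixed points `y` (`exists_approx_variational`). All `x_m`
with `m ≥ ρ(η)` are such points, so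
`‖x_{2m+2} - z‖² ≤ (1 - α_m) ‖x_{2m} - z‖² + 2 α_m ⟪u - z, x_{2m+1} - z⟫ + error`, and Xu's lemma
keeps the iterates close to `z` on the interval in question
(`IsHalpernMann.isRateOfMetastability_mu`).

Metastability gives a Cauchy sequence. Its limit is a fixed point, and the same recursion with `z`
the true projection of `u` identifies it.
-/

namespace DouglasRachford

variable {H : Type*} [NormedAddCommGroup H] [InnerProductSpace ℝ H]

/-! ### Maximal monotone operators and Minty's theorem -/

/-- A pair monotonically related to the graph of a maximal monotone operator belongs to it. -/
theorem mem_of_forall_inner_nonneg {A : H → Set H} (hA : IsMaximalMonotoneOperator A) {y w : H}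
    (h : ∀ q ∈ graph A, 0 ≤ inner ℝ (q.1 - y) (q.2 - w)) : w ∈ A y := by
  have key := hA.2 (fun x => A x ∪ {v | x = y ∧ v = w}) ?_ fun q hq => Or.inl hq
  · have hmem : (y, w) ∈ graph fun x => A x ∪ {v | x = y ∧ v = w} := Or.inr ⟨rfl, rfl⟩
    rw [key] at hmem
    exact hmem
  · rintro ⟨a, b⟩ hq ⟨a', b'⟩ hq'
    rcases hq with hq | ⟨rfl, rfl⟩ <;> rcases hq' with hq' | ⟨rfl, rfl⟩
    · exact hA.1 _ hq _ hq'
    · exact h _ hq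
    · have := h _ hq'
      rw [← inner_neg_neg]
      simpa using this
    · simp

theorem IsMaximalMonotoneOperator.scale {A : H → Set H} (hA : IsMaximalMonotoneOperator A)
    {c : ℝ} (hc : 0 < c) : IsMaximalMonotoneOperator (scale c A) := by
  refine ⟨?_, fun B hB hAB => (Set.Subset.antisymm · hAB) ?_⟩
  · rintro ⟨a, _⟩ ⟨v, hv, rfl⟩ ⟨a', _⟩ ⟨v', hv', rfl⟩
    have := hA.1 (a, v) hv (a', v') hv'
    rw [← smul_sub, real_inner_smul_right]
    positivity
  · rintro ⟨y, w⟩ hw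
    refine ⟨c⁻¹ • w, mem_of_forall_inner_nonneg hA ?_, (smul_inv_smul₀ hc.ne' w).symm⟩
    rintro ⟨a, v⟩ hv
    have := hB (a, c • v) (hAB ⟨v, hv, rfl⟩) (y, w) hw
    have e : v - c⁻¹ • w = c⁻¹ • (c • v - w) := by
      rw [smul_sub, inv_smul_smul₀ hc.ne']
    simp only [e, real_inner_smul_right]
    positivity

/-- A quadratic functional `(c, t) ↦ ‖c‖² + t` that is nonnegative on a convex set admits a common
solution `y` of the linearized inequalities: `y` is the limit of the first coordinates of a
minimizing sequence, which is Cauchy by the parallelogram law. No closedness is needed. -/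
theorem exists_forall_norm_sq_le_two_inner_add [CompleteSpace H] {K : Set (H × ℝ)}
    (hK : Convex ℝ K) (h : ∀ q ∈ K, 0 ≤ ‖q.1‖ ^ 2 + q.2) :
    ∃ y : H, ∀ q ∈ K, ‖y‖ ^ 2 ≤ 2 * inner ℝ y q.1 + q.2 := by
  rcases K.eq_empty_or_nonempty with rfl | hne
  · exact ⟨0, by simp⟩
  set Q : H × ℝ → ℝ := fun q => ‖q.1‖ ^ 2 + q.2
  set m := sInf (Q '' K)
  have hbdd : BddBelow (Q '' K) := ⟨0, by rintro _ ⟨q, hq, rfl⟩; exact h q hq⟩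
  have hm : ∀ q ∈ K, m ≤ ‖q.1‖ ^ 2 + q.2 := fun q hq => csInf_le hbdd ⟨q, hq, rfl⟩
  have hm0 : 0 ≤ m := le_csInf (hne.image _) (by rintro _ ⟨q, hq, rfl⟩; exact h q hq)
  have hseq : ∀ n : ℕ, ∃ q ∈ K, Q q < m + (1 / ((n : ℝ) + 1)) ^ 2 := by
    intro n
    obtain ⟨_, ⟨q, hq, rfl⟩, hlt⟩ := exists_lt_of_csInf_lt (hne.image Q)
      (show m < m + (1 / ((n : ℝ) + 1)) ^ 2 by
        have : 0 < (1 / ((n : ℝ) + 1)) ^ 2 := by positivity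
        linarith)
    exact ⟨q, hq, hlt⟩
  choose q hqK hq using hseq
  have hcauchy : CauchySeq fun n => (q n).1 := by
    refine cauchySeq_of_le_tendsto_0 (fun n : ℕ => 2 * (1 / ((n : ℝ) + 1))) ?_ ?_
    · intro i j n hi hj
      have hmid := hm _ (hK (hqK i) (hqK j) (by norm_num : (0 : ℝ) ≤ 1 / 2)
        (by norm_num : (0 : ℝ) ≤ 1 / 2) (by norm_num))
      have hpar := parallelogram_law_with_norm ℝ (q i).1 (q j).1
      have hmono : ∀ k, n ≤ k → (1 / ((k : ℝ) + 1)) ^ 2 ≤ (1 / ((n : ℝ) + 1)) ^ 2 := by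
        intro k hk
        gcongr
      have hi' := hmono i hi
      have hj' := hmono j hj
      have hqi : ‖(q i).1‖ ^ 2 + (q i).2 < _ := hq i
      have hqj : ‖(q j).1‖ ^ 2 + (q j).2 < _ := hq j
      simp only [Prod.fst_add, Prod.smul_fst, Prod.snd_add, Prod.smul_snd, smul_eq_mul,
        ← smul_add, norm_smul, mul_pow] at hmid
      norm_num at hmid
      rw [dist_eq_norm]
      refine abs_le_of_sq_le_sq' ?_ (by positivity) |>.2
      nlinarith
    · simpa using tendsto_one_div_add_atTop_nhds_zero_nat.const_mul (2 : ℝ)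
  obtain ⟨y, hy⟩ := cauchySeq_tendsto_of_complete hcauchy
  refine ⟨y, fun p hp => ?_⟩
  have hbound : ∀ n : ℕ, ‖(q n).1‖ ^ 2 ≤ 2 * inner ℝ (q n).1 p.1 + p.2 +
      1 / ((n : ℝ) + 1) * (1 + ‖p.1 - (q n).1‖ ^ 2) := by
    intro n
    -- The minimizing sequence is compared with the point at distance `s` along the segment to
    -- `p`; the error `s ^ 2` of the sequence makes the division by `s` harmless.
    set s : ℝ := 1 / ((n : ℝ) + 1)
    have hs : 0 < s := by positivity
    have hs1 : s ≤ 1 := by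
      rw [div_le_one (by positivity)]
      linarith [n.cast_nonneg (α := ℝ)]
    have hstep := hm _ (hK (hqK n) hp (by linarith : 0 ≤ 1 - s) hs.le (by ring))
    have e : (1 - s) • (q n).1 + s • p.1 = (q n).1 + s • (p.1 - (q n).1) := by module
    simp only [Prod.fst_add, Prod.smul_fst, Prod.snd_add, Prod.smul_snd, smul_eq_mul, e] at hstep
    rw [norm_add_sq_real, real_inner_smul_right, inner_sub_right, real_inner_self_eq_norm_sq,
      norm_smul, mul_pow, Real.norm_eq_abs, sq_abs] at hstep
    have hqn : ‖(q n).1‖ ^ 2 + (q n).2 < m + s ^ 2 := hq n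
    have hqn0 := h _ (hqK n)
    refine le_of_mul_le_mul_left ?_ hs
    nlinarith [mul_nonneg hs.le hqn0]
  refine le_of_tendsto_of_tendsto' (hy.norm.pow 2) ?_ hbound
  have h1 := ((hy.inner (tendsto_const_nhds (x := p.1))).const_mul (2 : ℝ)).add_const p.2
  have h2 := tendsto_one_div_add_atTop_nhds_zero_nat (𝕜 := ℝ) |>.mul
    (((tendsto_const_nhds (x := p.1)).sub hy).norm.pow 2 |>.const_add 1)
  simpa using h1.add h2

/-- Convex combinations of a monotone graph: if `(a, b, t)` lies in the convex hull of the triples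
`(a, b, ⟪a, b⟫)` over the graph, then `⟪a, b⟫ ≤ t`. Monotonicity says that the symmetric form
`t + t' - ⟪a, b'⟫ - ⟪a', b⟫` is nonnegative on pairs of generators; it is affine in each of the two
triples, so it is nonnegative on the hull. -/
theorem IsMonotoneOperator.inner_le_of_mem_convexHull {A : H → Set H} (hA : IsMonotoneOperator A)
    {q : H × H × ℝ}
    (hq : q ∈ convexHull ℝ ((fun r : H × H => (r.1, r.2, inner ℝ r.1 r.2)) '' graph A)) :
    inner ℝ q.1 q.2.1 ≤ q.2.2 := by
  have hconv : ∀ r : H × H × ℝ, Convex ℝ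
      {q : H × H × ℝ | inner ℝ q.1 r.2.1 + inner ℝ q.2.1 r.1 ≤ q.2.2 + r.2.2} := by
    intro r p hp p' hp' s s' hs hs' hss
    simp only [Set.mem_ofPred_eq, Prod.fst_add, Prod.smul_fst, Prod.snd_add, Prod.smul_snd,
      smul_eq_mul, inner_add_left, real_inner_smul_left] at hp hp' ⊢
    obtain rfl : s' = 1 - s := by linarith
    nlinarith [mul_le_mul_of_nonneg_left hp hs, mul_le_mul_of_nonneg_left hp' hs']
  have h1 : ∀ r ∈ graph A, inner ℝ q.1 r.2 + inner ℝ q.2.1 r.1 ≤ q.2.2 + inner ℝ r.1 r.2 := by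
    intro r hr
    refine convexHull_min ?_ (hconv (r.1, r.2, inner ℝ r.1 r.2)) hq
    rintro _ ⟨r', hr', rfl⟩
    have := hA r hr r' hr'
    simp only [inner_sub_left, inner_sub_right] at this
    simp only [Set.mem_ofPred_eq]
    rw [real_inner_comm r.1 r'.2]
    linarith
  have h2 := convexHull_min (t := {q' : H × H × ℝ |
      inner ℝ q'.1 q.2.1 + inner ℝ q'.2.1 q.1 ≤ q'.2.2 + q.2.2}) ?_ (hconv q) hq
  · simp only [Set.mem_ofPred_eq] at h2
    rw [real_inner_comm q.1 q.2.1] at h2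
    linarith
  · rintro _ ⟨r, hr, rfl⟩
    have := h1 r hr
    simp only [Set.mem_ofPred_eq]
    rw [real_inner_comm q.2.1 r.1, real_inner_comm q.1 r.2]
    linarith

/-- Minty's theorem: `I + A` is onto when `A` is maximal monotone. -/
theorem IsMaximalMonotoneOperator.exists_sub_mem [CompleteSpace H] {A : H → Set H}
    (hA : IsMaximalMonotoneOperator A) (x : H) : ∃ y, x - y ∈ A y := by
  -- After the translation `b ↦ b - x`, expanding `0 ≤ ⟪a - y, b + y⟫` gives
  -- `‖y‖² ≤ ⟪y, a - b⟫ + ⟪a, b⟫`, an inequality of the kind solved by the minimization lemma.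
  set B : H → Set H := fun a => {b | b + x ∈ A a}
  have hB : IsMonotoneOperator B := by
    rintro ⟨a, b⟩ hb ⟨a', b'⟩ hb'
    simpa using hA.1 (a, b + x) hb (a', b' + x) hb'
  set L : H × H × ℝ → H × ℝ := fun q => ((1 / 2 : ℝ) • (q.1 - q.2.1), q.2.2)
  have hL : IsLinearMap ℝ L := by
    constructor
    · rintro ⟨a, b, t⟩ ⟨a', b', t'⟩
      simp only [L, Prod.mk_add_mk, Prod.mk.injEq, and_true]
      module
    · rintro s ⟨a, b, t⟩
      simp only [L, Prod.smul_mk, Prod.mk.injEq, and_true]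
      module
  obtain ⟨y, hy⟩ := exists_forall_norm_sq_le_two_inner_add
    (((convex_convexHull ℝ ((fun r : H × H => (r.1, r.2, inner ℝ r.1 r.2)) ''
      graph B)).is_linear_image hL)) (by
      rintro _ ⟨⟨a, b, t⟩, hq, rfl⟩
      have h1 : inner ℝ a b ≤ t := hB.inner_le_of_mem_convexHull hq
      have h2 := norm_sub_sq_real a b
      have h3 := norm_add_sq_real a b
      simp only [L, norm_smul, mul_pow]
      norm_num
      nlinarith [sq_nonneg ‖a + b‖])
  refine ⟨y, mem_of_forall_inner_nonneg hA ?_⟩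
  rintro ⟨a, b⟩ hb
  have hb' : (a, b - x) ∈ graph B := by
    change b - x + x ∈ A a
    rwa [sub_add_cancel]
  have := hy _ ⟨_, subset_convexHull ℝ _ ⟨_, hb', rfl⟩, rfl⟩
  simp only [L, real_inner_smul_right, inner_sub_right, real_inner_comm] at this
  simp only [inner_sub_left, inner_sub_right, real_inner_self_eq_norm_sq]
  simp only [real_inner_comm] at this ⊢
  linarith [real_inner_comm a y]

theorem IsMaximalMonotoneOperator.sub_resolvent_mem [CompleteSpace H] {A : H → Set H}
    (hA : IsMaximalMonotoneOperator A) (x : H) : x - resolvent A x ∈ A (resolvent A x) :=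
  Classical.epsilon_spec (hA.exists_sub_mem x)

/-- The resolvent of a maximal monotone operator is firmly nonexpansive. -/
theorem IsMaximalMonotoneOperator.norm_sq_resolvent_sub_le [CompleteSpace H] {A : H → Set H}
    (hA : IsMaximalMonotoneOperator A) (x x' : H) :
    ‖resolvent A x - resolvent A x'‖ ^ 2 ≤ inner ℝ (resolvent A x - resolvent A x') (x - x') := by
  have h := hA.1 (resolvent A x, x - resolvent A x) (hA.sub_resolvent_mem x)
    (resolvent A x', x' - resolvent A x') (hA.sub_resolvent_mem x')
  rw [sub_sub_sub_comm, inner_sub_right, real_inner_self_eq_norm_sq] at h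
  linarith

theorem IsMaximalMonotoneOperator.norm_resolvent_sub_le [CompleteSpace H] {A : H → Set H}
    (hA : IsMaximalMonotoneOperator A) (x x' : H) :
    ‖resolvent A x - resolvent A x'‖ ≤ ‖x - x'‖ := by
  have h := hA.norm_sq_resolvent_sub_le x x'
  have h' := real_inner_le_norm (resolvent A x - resolvent A x') (x - x')
  nlinarith [norm_nonneg (resolvent A x - resolvent A x'), norm_nonneg (x - x')]

theorem IsMaximalMonotoneOperator.norm_reflectedResolvent_sub_le [CompleteSpace H]
    {A : H → Set H} (hA : IsMaximalMonotoneOperator A) (x x' : H) :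
    ‖reflectedResolvent A x - reflectedResolvent A x'‖ ≤ ‖x - x'‖ := by
  have h := hA.norm_sq_resolvent_sub_le x x'
  have e : reflectedResolvent A x - reflectedResolvent A x' =
      (2 : ℝ) • (resolvent A x - resolvent A x') - (x - x') := by
    unfold reflectedResolvent
    module
  refine abs_le_of_sq_le_sq' ?_ (norm_nonneg _) |>.2
  rw [e, norm_sub_sq_real, real_inner_smul_left, norm_smul, mul_pow]
  norm_num
  linarith

/-- At a fixed point `x` of `R_A ∘ R_B` the vectors `x - J_B x ∈ B (J_B x)` and
`J_B x - x ∈ A (J_B x)` are opposite. -/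
theorem resolvent_reflectedResolvent_eq {A B : H → Set H} {x : H}
    (hx : x ∈ Function.fixedPoints (reflectedResolvent A ∘ reflectedResolvent B)) :
    resolvent A (reflectedResolvent B x) = resolvent B x := by
  have h : (2 : ℝ) • resolvent A (reflectedResolvent B x) - ((2 : ℝ) • resolvent B x - x) = x := hx
  have h2 : (2 : ℝ) • resolvent A (reflectedResolvent B x) = (2 : ℝ) • resolvent B x := by
    rw [sub_eq_iff_eq_add] at h
    rw [h]
    abel
  exact smul_right_injective H (two_ne_zero' ℝ) h2

theorem resolvent_mem_zer_sum [CompleteSpace H] {A B : H → Set H}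
    (hA : IsMaximalMonotoneOperator A) (hB : IsMaximalMonotoneOperator B) {c : ℝ} (hc : 0 < c)
    {x : H} (hx : x ∈ Function.fixedPoints
      (reflectedResolvent (scale c A) ∘ reflectedResolvent (scale c B))) :
    resolvent (scale c B) x ∈ zer (sum A B) := by
  have h1 := (hA.scale hc).sub_resolvent_mem (reflectedResolvent (scale c B) x)
  obtain ⟨b, hb, hbe⟩ := (hB.scale hc).sub_resolvent_mem x
  rw [resolvent_reflectedResolvent_eq hx] at h1
  obtain ⟨a, ha, hae⟩ := h1
  refine ⟨a, ha, b, hb, ?_⟩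
  have : c • (a + b) = 0 := by
    rw [smul_add, ← hae, ← hbe, reflectedResolvent]
    module
  exact ((smul_eq_zero_iff_right hc.ne').1 this).symm

/-! ### Recursive inequalities with explicit rates -/

/-- The recursion `s (n + 1) ≤ (1 - a n) s n + a n r + c n` unrolled from `K` to `n`, with
`∏ (1 - a i)` replaced by the exponential bound. -/
theorem le_exp_neg_sum_mul_add {a s c : ℕ → ℝ} (ha : ∀ n, a n ∈ Set.Icc (0 : ℝ) 1) {r : ℝ}
    (hc : ∀ n, 0 ≤ c n) {K n : ℕ} (hsK : 0 ≤ s K) (hKn : K ≤ n) (hr : 0 ≤ r)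
    (hrec : ∀ i, K ≤ i → i < n → s (i + 1) ≤ (1 - a i) * s i + a i * r + c i) :
    s n ≤ Real.exp (-∑ i ∈ Finset.Ico K n, a i) * s K + r + ∑ i ∈ Finset.Ico K n, c i := by
  induction n, hKn using Nat.le_induction with
  | base => simpa using hr
  | succ n hKn ih =>
    have ih' := ih fun i hi hin => hrec i hi (by omega)
    have hstep := hrec n hKn (by omega)
    obtain ⟨ha0, ha1⟩ := ha n
    rw [Finset.sum_Ico_succ_top hKn, Finset.sum_Ico_succ_top hKn, neg_add, Real.exp_add]
    have hC : 0 ≤ ∑ i ∈ Finset.Ico K n, c i := Finset.sum_nonneg fun i _ => hc i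
    set C := ∑ i ∈ Finset.Ico K n, c i
    set E := Real.exp (-∑ i ∈ Finset.Ico K n, a i)
    have hE : 0 ≤ E * s K := mul_nonneg (Real.exp_pos _).le hsK
    have hexp : 1 - a n ≤ Real.exp (-a n) := Real.one_sub_le_exp_neg (a n)
    calc s (n + 1) ≤ (1 - a n) * s n + a n * r + c n := hstep
      _ ≤ (1 - a n) * (E * s K + r + C) + a n * r + c n := by
        gcongr
      _ = (1 - a n) * (E * s K) + r + (C + c n) - a n * C := by ring
      _ ≤ Real.exp (-a n) * (E * s K) + r + (C + c n) := by
        have h1 := mul_le_mul_of_nonneg_right hexp hE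
        have h2 := mul_nonneg ha0 hC
        linarith
      _ = _ := by ring

/-- Xu's lemma with a rate: after index `A (K + ⌈ln (D / e)⌉)` the weights accumulated since `K`
reduce an initial value at most `D` below `e`. -/
theorem le_of_weighted_recursion {a s c : ℕ → ℝ} {A : ℕ → ℕ} (ha : ∀ n, a n ∈ Set.Icc (0 : ℝ) 1)
    (hA : IsRateOfDivergenceOfSum a A) {r D e : ℝ} (hr : 0 ≤ r) (hD : 0 < D) (he : 0 < e)
    (hc : ∀ n, 0 ≤ c n) {K n : ℕ} (hs : 0 ≤ s K) (hsD : s K ≤ D)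
    (hn : A (K + ⌈Real.log (D / e)⌉₊) + 1 ≤ n)
    (hrec : ∀ i, K ≤ i → i < n → s (i + 1) ≤ (1 - a i) * s i + a i * r + c i) :
    s n ≤ e + r + ∑ i ∈ Finset.Ico K n, c i := by
  have hle : ∀ m, ∑ i ∈ Finset.range m, a i ≤ m := fun m => by
    simpa using Finset.sum_le_card_nsmul (Finset.range m) a 1 fun i _ => (ha i).2
  have hdiv := hA (K + ⌈Real.log (D / e)⌉₊)
  push_cast at hdiv
  have hKn : K ≤ n := by
    have := hdiv.trans (hle _)
    have h : K + ⌈Real.log (D / e)⌉₊ ≤ A (K + ⌈Real.log (D / e)⌉₊) + 1 := by exact_mod_cast this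
    omega
  have hmono := Finset.sum_le_sum_of_subset_of_nonneg (Finset.range_mono hn)
    fun i _ _ => (ha i).1
  have hlog : Real.log (D / e) ≤ ∑ i ∈ Finset.Ico K n, a i := by
    have h1 := Finset.sum_range_add_sum_Ico a hKn
    have h2 := hle K
    have h3 := Nat.le_ceil (Real.log (D / e))
    linarith
  have hexp : Real.exp (-∑ i ∈ Finset.Ico K n, a i) * D ≤ e := by
    have h := (Real.log_le_iff_le_exp (by positivity)).1 hlog
    rw [Real.exp_neg, inv_mul_le_iff₀ (Real.exp_pos _)]
    rwa [div_le_iff₀ he] at h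
  have hmain := le_exp_neg_sum_mul_add ha hc hs hKn hr hrec
  have := mul_le_mul_of_nonneg_left hsD (Real.exp_pos (-∑ i ∈ Finset.Ico K n, a i)).le
  linarith

theorem IsCauchyRateOfSum.sum_Ico_le {b : ℕ → ℝ} {g : ℝ → ℕ} (hg : IsCauchyRateOfSum b g)
    (hb : ∀ n, 0 ≤ b n) {ε : ℝ} (hε : 0 < ε) {m : ℕ} (hm : g ε + 1 ≤ m) (n : ℕ) :
    ∑ i ∈ Finset.Ico m n, b i ≤ ε := by
  refine le_trans (Finset.sum_le_sum_of_subset_of_nonneg ?_ fun i _ _ => hb i) (hg ε hε n)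
  intro i hi
  simp only [Finset.mem_Ico, Finset.mem_Icc] at hi ⊢
  omega

/-! ### The alternating Halpern–Mann iteration -/

/-- `x` alternates a Halpern step towards the anchor `u` (odd indices) and a Krasnoselskii–Mann
step of the nonexpansive map `T` with relaxation weight `b n` (even indices). -/
structure IsHalpernMann (T : H → H) (u : H) (α b : ℕ → ℝ) (x : ℕ → H) : Prop where
  nonexpansive : ∀ a a', ‖T a - T a'‖ ≤ ‖a - a'‖
  anchor_mem : ∀ n, α n ∈ Set.Icc (0 : ℝ) 1
  relax_mem : ∀ n, b n ∈ Set.Icc (0 : ℝ) 1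
  odd : ∀ n, x (2 * n + 1) = (1 - α n) • x (2 * n) + α n • u
  even : ∀ n, x (2 * n + 2) = (1 - b n) • x (2 * n + 1) + b n • T (x (2 * n + 1))

theorem norm_sub_mul_smul_add_sq (v w : H) (t : ℝ) :
    ‖(1 - t) • v + t • w‖ ^ 2 =
      (1 - t) * ‖v‖ ^ 2 + t * ‖w‖ ^ 2 - t * (1 - t) * ‖v - w‖ ^ 2 := by
  rw [norm_add_sq_real, norm_sub_sq_real, norm_smul, norm_smul, real_inner_smul_left,
    real_inner_smul_right, mul_pow, mul_pow, Real.norm_eq_abs, Real.norm_eq_abs, sq_abs, sq_abs]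
  ring

theorem norm_one_sub_smul_add_le {t : ℝ} (ht : t ∈ Set.Icc (0 : ℝ) 1) {v w : H} {M : ℝ}
    (hv : ‖v‖ ≤ M) (hw : ‖w‖ ≤ M) : ‖(1 - t) • v + t • w‖ ≤ M := by
  have h := norm_add_le ((1 - t) • v) (t • w)
  rw [norm_smul, norm_smul, Real.norm_of_nonneg ht.1, Real.norm_of_nonneg (sub_nonneg.2 ht.2)] at h
  nlinarith [mul_le_mul_of_nonneg_left hv (sub_nonneg.2 ht.2), mul_le_mul_of_nonneg_left hw ht.1]

namespace IsHalpernMann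

variable {T : H → H} {u p : H} {α b : ℕ → ℝ} {x : ℕ → H}

theorem odd_sub (h : IsHalpernMann T u α b x) (n : ℕ) (q : H) :
    x (2 * n + 1) - q = (1 - α n) • (x (2 * n) - q) + α n • (u - q) := by
  rw [h.odd]
  module

theorem even_sub (h : IsHalpernMann T u α b x) (n : ℕ) (q : H) :
    x (2 * n + 2) - q =
      (1 - b n) • (x (2 * n + 1) - q) + b n • (T (x (2 * n + 1)) - q) := by
  rw [h.even]
  module

theorem norm_sub_fixedPoint_le (h : IsHalpernMann T u α b x) (hp : T p = p) {M : ℝ}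
    (hx : ‖x 0 - p‖ ≤ M) (hu : ‖u - p‖ ≤ M) (n : ℕ) : ‖x n - p‖ ≤ M := by
  have hodd : ∀ n, ‖x (2 * n) - p‖ ≤ M → ‖x (2 * n + 1) - p‖ ≤ M := fun n hn => by
    rw [h.odd_sub]
    exact norm_one_sub_smul_add_le (h.anchor_mem n) hn hu
  have heven : ∀ n, ‖x (2 * n) - p‖ ≤ M := by
    intro n
    induction n with
    | zero => exact hx
    | succ n ih =>
      have := hodd n ih
      rw [show 2 * (n + 1) = 2 * n + 2 by ring, h.even_sub]
      refine norm_one_sub_smul_add_le (h.relax_mem n) this (le_trans ?_ this)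
      simpa only [hp] using h.nonexpansive (x (2 * n + 1)) p
  obtain ⟨k, rfl | rfl⟩ := Nat.even_or_odd' n
  · exact heven k
  · exact hodd k (heven k)

theorem norm_even_sub_even_le (h : IsHalpernMann T u α b x) (n : ℕ) :
    ‖x (2 * n + 4) - x (2 * n + 2)‖ ≤ (1 - α (n + 1)) * ‖x (2 * n + 2) - x (2 * n)‖ +
      (|α (n + 1) - α n| * ‖x (2 * n) - u‖ +
        |b (n + 1) - b n| * ‖T (x (2 * n + 1)) - x (2 * n + 1)‖) := by
  have h1 : x (2 * n + 3) - x (2 * n + 1) =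
      (1 - α (n + 1)) • (x (2 * n + 2) - x (2 * n)) - (α (n + 1) - α n) • (x (2 * n) - u) := by
    rw [h.odd n, show 2 * n + 3 = 2 * (n + 1) + 1 by ring, h.odd (n + 1),
      show 2 * (n + 1) = 2 * n + 2 by ring]
    module
  have h2 : x (2 * n + 4) - x (2 * n + 2) =
      ((1 - b (n + 1)) • (x (2 * n + 3) - x (2 * n + 1)) +
        b (n + 1) • (T (x (2 * n + 3)) - T (x (2 * n + 1)))) +
      (b (n + 1) - b n) • (T (x (2 * n + 1)) - x (2 * n + 1)) := by
    rw [h.even n, show 2 * n + 4 = 2 * (n + 1) + 2 by ring, h.even (n + 1),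
      show 2 * (n + 1) + 1 = 2 * n + 3 by ring]
    module
  have h3 : ‖x (2 * n + 3) - x (2 * n + 1)‖ ≤
      (1 - α (n + 1)) * ‖x (2 * n + 2) - x (2 * n)‖ + |α (n + 1) - α n| * ‖x (2 * n) - u‖ := by
    rw [h1]
    refine (norm_sub_le _ _).trans_eq ?_
    rw [norm_smul, norm_smul, Real.norm_of_nonneg (sub_nonneg.2 (h.anchor_mem _).2),
      Real.norm_eq_abs]
  have h4 : ‖x (2 * n + 4) - x (2 * n + 2)‖ ≤ ‖x (2 * n + 3) - x (2 * n + 1)‖ +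
      |b (n + 1) - b n| * ‖T (x (2 * n + 1)) - x (2 * n + 1)‖ := by
    rw [h2]
    refine (norm_add_le _ _).trans ?_
    rw [norm_smul _ (T _ - _), Real.norm_eq_abs]
    gcongr
    exact norm_one_sub_smul_add_le (h.relax_mem _) le_rfl (h.nonexpansive _ _)
  linarith

/-- `θ₁` is a rate of convergence of `‖x (2 n + 2) - x (2 n)‖` to zero. -/
theorem norm_even_sub_even_le_of_theta1_le (h : IsHalpernMann T u α b x) (hp : T p = p) {N : ℕ}
    (hN : N ≠ 0) (hx : ‖x 0 - p‖ ≤ N) (hu : 2 * ‖u - p‖ ≤ N) {Γ₂ : ℕ → ℕ} {Γ₃ Γ₄ : ℝ → ℕ}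
    (hΓ₂ : IsRateOfDivergenceOfSum α Γ₂)
    (hΓ₃ : IsCauchyRateOfSum (fun n => |α (n + 1) - α n|) Γ₃)
    (hΓ₄ : IsCauchyRateOfSum (fun n => |b (n + 1) - b n|) Γ₄) {ε : ℝ} (hε : 0 < ε) {n : ℕ}
    (hn : theta1 N Γ₂ Γ₃ Γ₄ ε ≤ n) : ‖x (2 * n + 2) - x (2 * n)‖ ≤ ε := by
  have hN0 : (0 : ℝ) < N := by positivity
  have hpu : ‖p - u‖ ≤ N / 2 := by
    rw [norm_sub_rev]
    linarith
  have hb := h.norm_sub_fixedPoint_le hp hx (by linarith [norm_nonneg (u - p)])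
  have hxu : ∀ k, ‖x k - u‖ ≤ 2 * N := fun k => by
    have := norm_sub_le_norm_sub_add_norm_sub (x k) p u
    linarith [hb k]
  have hTx : ∀ k, ‖T (x k) - x k‖ ≤ 2 * N := fun k => by
    have h1 := norm_sub_le_norm_sub_add_norm_sub (T (x k)) p (x k)
    have h2 := h.nonexpansive (x k) p
    rw [hp] at h2
    rw [norm_sub_rev p] at h1
    linarith [hb k]
  set c : ℕ → ℝ := fun n => 2 * N * |α (n + 1) - α n| + 2 * N * |b (n + 1) - b n|
  set δ := ε / 2 / (4 * N)
  have hδ : 0 < δ := by positivity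
  -- The recursion carries the shifted weights `α (n + 1)`; the lost term `α 0` is at most one.
  have hdiv : IsRateOfDivergenceOfSum (fun n => α (n + 1)) (fun k => Γ₂ (k + 1)) := by
    intro k
    have h1 := hΓ₂ (k + 1)
    rw [Finset.sum_range_succ'] at h1
    rw [Finset.sum_range_succ]
    push_cast at h1
    linarith [(h.anchor_mem 0).2, (h.anchor_mem (Γ₂ (k + 1) + 1)).1]
  have key := le_of_weighted_recursion (a := fun n => α (n + 1))
    (s := fun n => ‖x (2 * n + 2) - x (2 * n)‖) (c := c) (r := 0) (D := 2 * N) (e := ε / 2)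
    (K := max (Γ₃ δ) (Γ₄ δ) + 1) (n := n)
    (fun n => h.anchor_mem _) hdiv le_rfl (by positivity) (by positivity)
    (fun n => by positivity) (norm_nonneg _) ?_ ?_ ?_
  · have hc : ∑ i ∈ Finset.Ico (max (Γ₃ δ) (Γ₄ δ) + 1) n, c i ≤ ε / 2 := by
      simp only [c]
      rw [Finset.sum_add_distrib, ← Finset.mul_sum, ← Finset.mul_sum]
      have h1 := hΓ₃.sum_Ico_le (fun _ => abs_nonneg _) hδ
        (show _ ≤ max (Γ₃ δ) (Γ₄ δ) + 1 by simp) n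
      have h2 := hΓ₄.sum_Ico_le (fun _ => abs_nonneg _) hδ
        (show _ ≤ max (Γ₃ δ) (Γ₄ δ) + 1 by simp) n
      have e : ε / 2 = 2 * N * δ + 2 * N * δ := by
        simp only [δ]
        field_simp
        norm_num
      rw [e]
      gcongr
    linarith
  · have h1 := norm_sub_le_norm_sub_add_norm_sub (x (2 * (max (Γ₃ δ) (Γ₄ δ) + 1) + 2)) p
      (x (2 * (max (Γ₃ δ) (Γ₄ δ) + 1)))
    rw [norm_sub_rev p] at h1
    linarith [hb (2 * (max (Γ₃ δ) (Γ₄ δ) + 1) + 2), hb (2 * (max (Γ₃ δ) (Γ₄ δ) + 1))]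
  · unfold theta1 thetaHat at hn
    push_cast at hn
    rw [show 2 * (2 * (N : ℝ)) / ε = 2 * N / (ε / 2) by field_simp] at hn
    refine le_of_eq_of_le ?_ hn
    simp only [δ]
    congr 2
    omega
  · intro i _ _
    refine (h.norm_even_sub_even_le i).trans ?_
    simp only [c]
    rw [mul_zero, add_zero, mul_comm (2 * (N : ℝ)), mul_comm (2 * (N : ℝ))]
    gcongr
    exacts [hxu _, hTx _]

/-- The residual after a Mann step is controlled by the displacement of two consecutive even
iterates, through the strict convexity of the squared norm. -/
theorem sq_mul_norm_residual_le (h : IsHalpernMann T u α b x) (hp : T p = p) {N : ℝ}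
    (hx : ‖x 0 - p‖ ≤ N) (hu : 2 * ‖u - p‖ ≤ N) {γ : ℝ} (hγ : 0 < γ)
    (hb : ∀ n, γ ≤ b n ∧ b n ≤ 1 - γ) (n : ℕ) :
    (γ * ‖T (x (2 * n + 1)) - x (2 * n + 1)‖) ^ 2 ≤
      2 * N * ‖x (2 * n + 2) - x (2 * n)‖ + α n * N ^ 2 / 4 := by
  have hbd := h.norm_sub_fixedPoint_le hp hx (by linarith [norm_nonneg (u - p)])
  obtain ⟨ha0, ha1⟩ := h.anchor_mem n
  obtain ⟨hb0, hb1⟩ := hb n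
  have h1 := congrArg (fun v => ‖v‖ ^ 2) (h.even_sub n p)
  have h2 := congrArg (fun v => ‖v‖ ^ 2) (h.odd_sub n p)
  simp only [norm_sub_mul_smul_add_sq, sub_sub_sub_cancel_right] at h1 h2
  rw [norm_sub_rev (x (2 * n + 1)) (T _)] at h1
  have h3 : ‖T (x (2 * n + 1)) - p‖ ^ 2 ≤ ‖x (2 * n + 1) - p‖ ^ 2 := by
    have := h.nonexpansive (x (2 * n + 1)) p
    rw [hp] at this
    gcongr
  have h4 : ‖u - p‖ ^ 2 ≤ N ^ 2 / 4 := by nlinarith [norm_nonneg (u - p)]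
  have h5 : γ ^ 2 * ‖T (x (2 * n + 1)) - x (2 * n + 1)‖ ^ 2 ≤
      b n * (1 - b n) * ‖T (x (2 * n + 1)) - x (2 * n + 1)‖ ^ 2 := by
    gcongr
    nlinarith
  have h6 : ‖x (2 * n) - p‖ ^ 2 - ‖x (2 * n + 2) - p‖ ^ 2 ≤
      2 * N * ‖x (2 * n + 2) - x (2 * n)‖ := by
    have h7 := norm_sub_norm_le (x (2 * n) - p) (x (2 * n + 2) - p)
    rw [sub_sub_sub_cancel_right, norm_sub_rev (x (2 * n)) (x (2 * n + 2))] at h7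
    have h8 := norm_nonneg (x (2 * n) - p)
    have h9 := norm_nonneg (x (2 * n + 2) - p)
    have h10 := norm_nonneg (x (2 * n + 2) - x (2 * n))
    nlinarith [hbd (2 * n), hbd (2 * n + 2)]
  have h11 : 0 ≤ α n * (1 - α n) * ‖x (2 * n) - u‖ ^ 2 :=
    mul_nonneg (mul_nonneg ha0 (sub_nonneg.2 ha1)) (sq_nonneg _)
  have h12 := mul_le_mul_of_nonneg_left h3 (hγ.le.trans hb0)
  have h13 := mul_le_mul_of_nonneg_left h4 ha0
  have h14 := mul_nonneg ha0 (sq_nonneg ‖x (2 * n) - p‖)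
  rw [mul_pow]
  linarith

/-- `θ₃` is a rate of convergence of the residual `‖T v - v‖` to zero along the odd iterates. -/
theorem norm_residual_le_of_theta3_le (h : IsHalpernMann T u α b x) (hp : T p = p) {N : ℕ}
    (hN : N ≠ 0) (hx : ‖x 0 - p‖ ≤ N) (hu : 2 * ‖u - p‖ ≤ N) {γ : ℝ} (hγ : 0 < γ)
    (hb : ∀ n, γ ≤ b n ∧ b n ≤ 1 - γ) {Γ₁ : ℝ → ℕ} {Γ₂ : ℕ → ℕ} {Γ₃ Γ₄ : ℝ → ℕ}
    (hΓ₁ : IsRateOfConvergenceToZero α Γ₁) (hΓ₂ : IsRateOfDivergenceOfSum α Γ₂)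
    (hΓ₃ : IsCauchyRateOfSum (fun n => |α (n + 1) - α n|) Γ₃)
    (hΓ₄ : IsCauchyRateOfSum (fun n => |b (n + 1) - b n|) Γ₄) {ε : ℝ} (hε : 0 < ε) {n : ℕ}
    (hn : theta3 N γ Γ₁ Γ₂ Γ₃ Γ₄ ε ≤ n) : ‖T (x (2 * n + 1)) - x (2 * n + 1)‖ ≤ ε := by
  have hN0 : (0 : ℝ) < N := by positivity
  have h1 := h.norm_even_sub_even_le_of_theta1_le hp hN hx hu hΓ₂ hΓ₃ hΓ₄
    (by positivity) ((le_max_left _ _).trans hn)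
  have h2 := (le_abs_self _).trans
    (hΓ₁ ((γ * ε) ^ 2 / (2 * N ^ 2)) (by positivity) n ((le_max_right _ _).trans hn))
  have h3 := h.sq_mul_norm_residual_le hp hx hu hγ hb n
  rw [le_div_iff₀ (by positivity)] at h1 h2
  have h4 : γ * ‖T (x (2 * n + 1)) - x (2 * n + 1)‖ ≤ γ * ε := by
    refine abs_le_of_sq_le_sq' ?_ (by positivity) |>.2
    nlinarith [sq_nonneg (γ * ε)]
  exact le_of_mul_le_mul_left h4 hγ

/-- `θ₄` is a rate of convergence of `‖x (2 n + 1) - x (2 n)‖` to zero. -/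
theorem norm_odd_sub_even_le_of_theta4_le (h : IsHalpernMann T u α b x) (hp : T p = p) {N : ℕ}
    (hN : N ≠ 0) (hx : ‖x 0 - p‖ ≤ N) (hu : 2 * ‖u - p‖ ≤ N) {γ : ℝ} (hγ : 0 < γ)
    (hb : ∀ n, γ ≤ b n ∧ b n ≤ 1 - γ) {Γ₁ : ℝ → ℕ} {Γ₂ : ℕ → ℕ} {Γ₃ Γ₄ : ℝ → ℕ}
    (hΓ₁ : IsRateOfConvergenceToZero α Γ₁) (hΓ₂ : IsRateOfDivergenceOfSum α Γ₂)
    (hΓ₃ : IsCauchyRateOfSum (fun n => |α (n + 1) - α n|) Γ₃)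
    (hΓ₄ : IsCauchyRateOfSum (fun n => |b (n + 1) - b n|) Γ₄) {ε : ℝ} (hε : 0 < ε) {n : ℕ}
    (hn : theta4 N γ Γ₁ Γ₂ Γ₃ Γ₄ ε ≤ n) : ‖x (2 * n + 1) - x (2 * n)‖ ≤ ε := by
  have h1 := h.norm_even_sub_even_le_of_theta1_le hp hN hx hu hΓ₂ hΓ₃ hΓ₄
    (half_pos hε) ((le_max_left _ _).trans hn)
  have h2 := h.norm_residual_le_of_theta3_le hp hN hx hu hγ hb hΓ₁ hΓ₂ hΓ₃ hΓ₄
    (half_pos hε) ((le_max_right _ _).trans hn)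
  have h3 : x (2 * n + 1) - x (2 * n) =
      (x (2 * n + 2) - x (2 * n)) - b n • (T (x (2 * n + 1)) - x (2 * n + 1)) := by
    rw [h.even n]
    module
  have h4 := norm_sub_le (x (2 * n + 2) - x (2 * n)) (b n • (T (x (2 * n + 1)) - x (2 * n + 1)))
  rw [← h3, norm_smul, Real.norm_of_nonneg (h.relax_mem n).1] at h4
  have h5 := mul_le_mul_of_nonneg_right (h.relax_mem n).2
    (norm_nonneg (T (x (2 * n + 1)) - x (2 * n + 1)))
  linarith

/-- `ρ` is a rate of convergence of the residual `‖T x - x‖` to zero along the whole sequence: a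
Mann step does not increase the residual. -/
theorem norm_residual_le_of_rho_le (h : IsHalpernMann T u α b x) (hp : T p = p) {N : ℕ}
    (hN : N ≠ 0) (hx : ‖x 0 - p‖ ≤ N) (hu : 2 * ‖u - p‖ ≤ N) {γ : ℝ} (hγ : 0 < γ)
    (hb : ∀ n, γ ≤ b n ∧ b n ≤ 1 - γ) {Γ₁ : ℝ → ℕ} {Γ₂ : ℕ → ℕ} {Γ₃ Γ₄ : ℝ → ℕ}
    (hΓ₁ : IsRateOfConvergenceToZero α Γ₁) (hΓ₂ : IsRateOfDivergenceOfSum α Γ₂)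
    (hΓ₃ : IsCauchyRateOfSum (fun n => |α (n + 1) - α n|) Γ₃)
    (hΓ₄ : IsCauchyRateOfSum (fun n => |b (n + 1) - b n|) Γ₄) {ε : ℝ} (hε : 0 < ε) {m : ℕ}
    (hm : rho N γ Γ₁ Γ₂ Γ₃ Γ₄ ε ≤ m) : ‖T (x m) - x m‖ ≤ ε := by
  have hm2 : 2 * theta3 N γ Γ₁ Γ₂ Γ₃ Γ₄ (ε / 3) + 2 ≤ m := (le_max_left _ _).trans hm
  have hodd : ∀ n, theta3 N γ Γ₁ Γ₂ Γ₃ Γ₄ (ε / 3) ≤ n →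
      ‖T (x (2 * n + 1)) - x (2 * n + 1)‖ ≤ ε := fun n hn => by
    have := h.norm_residual_le_of_theta3_le hp hN hx hu hγ hb hΓ₁ hΓ₂ hΓ₃ hΓ₄
      (by positivity : 0 < ε / 3) hn
    linarith
  obtain ⟨k, rfl | rfl⟩ := Nat.even_or_odd' m
  · obtain ⟨k, rfl⟩ := Nat.exists_eq_add_of_lt (show 0 < k by omega)
    rw [show 2 * (0 + k + 1) = 2 * k + 2 by ring]
    refine le_trans ?_ (hodd k (by omega))
    obtain ⟨hb0, hb1⟩ := h.relax_mem k
    have e1 : x (2 * k + 2) - x (2 * k + 1) = b k • (T (x (2 * k + 1)) - x (2 * k + 1)) := by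
      rw [h.even]
      module
    have e2 : T (x (2 * k + 1)) - x (2 * k + 2) =
        (1 - b k) • (T (x (2 * k + 1)) - x (2 * k + 1)) := by
      rw [h.even]
      module
    have h1 := norm_sub_le_norm_sub_add_norm_sub (T (x (2 * k + 2))) (T (x (2 * k + 1)))
      (x (2 * k + 2))
    have h2 := h.nonexpansive (x (2 * k + 2)) (x (2 * k + 1))
    rw [e1, norm_smul, Real.norm_of_nonneg hb0] at h2
    rw [e2, norm_smul, Real.norm_of_nonneg (sub_nonneg.2 hb1)] at h1
    linarith
  · exact hodd k (by omega)

end IsHalpernMann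

/-! ### Monotonicity of the rates -/

theorem theta1_antitoneOn {N : ℕ} (hN : N ≠ 0) {Γ₂ : ℕ → ℕ} {Γ₃ Γ₄ : ℝ → ℕ} (h₂ : Monotone Γ₂)
    (h₃ : AntitoneOn Γ₃ (Set.Ioi 0)) (h₄ : AntitoneOn Γ₄ (Set.Ioi 0)) :
    AntitoneOn (theta1 N Γ₂ Γ₃ Γ₄) (Set.Ioi 0) := by
  intro a ha a' ha' haa'
  rw [Set.mem_Ioi] at ha ha'
  have hN0 : (0 : ℝ) < N := by positivity
  have hle : a / 2 / (4 * N) ≤ a' / 2 / (4 * N) := by gcongr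
  have hpos : (0 : ℝ) < a / 2 / (4 * N) := by positivity
  have h3 := h₃ hpos (hpos.trans_le hle) hle
  have h4 := h₄ hpos (hpos.trans_le hle) hle
  unfold theta1 thetaHat
  refine Nat.add_le_add_right (h₂ ?_) 1
  gcongr
  exact max_le_max h3 h4

theorem theta3_antitoneOn {N : ℕ} (hN : N ≠ 0) {γ : ℝ} (hγ : 0 < γ) {Γ₁ : ℝ → ℕ} {Γ₂ : ℕ → ℕ}
    {Γ₃ Γ₄ : ℝ → ℕ} (h₁ : AntitoneOn Γ₁ (Set.Ioi 0)) (h₂ : Monotone Γ₂)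
    (h₃ : AntitoneOn Γ₃ (Set.Ioi 0)) (h₄ : AntitoneOn Γ₄ (Set.Ioi 0)) :
    AntitoneOn (theta3 N γ Γ₁ Γ₂ Γ₃ Γ₄) (Set.Ioi 0) := by
  intro a ha a' ha' haa'
  rw [Set.mem_Ioi] at ha ha'
  have hN0 : (0 : ℝ) < N := by positivity
  refine max_le_max (theta1_antitoneOn hN h₂ h₃ h₄ (Set.mem_Ioi.2 (by positivity))
    (Set.mem_Ioi.2 (by positivity)) (by gcongr))
    (h₁ (Set.mem_Ioi.2 (by positivity)) (Set.mem_Ioi.2 (by positivity)) (by gcongr))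

theorem rho_antitoneOn {N : ℕ} (hN : N ≠ 0) {γ : ℝ} (hγ : 0 < γ) {Γ₁ : ℝ → ℕ} {Γ₂ : ℕ → ℕ}
    {Γ₃ Γ₄ : ℝ → ℕ} (h₁ : AntitoneOn Γ₁ (Set.Ioi 0)) (h₂ : Monotone Γ₂)
    (h₃ : AntitoneOn Γ₃ (Set.Ioi 0)) (h₄ : AntitoneOn Γ₄ (Set.Ioi 0)) :
    AntitoneOn (rho N γ Γ₁ Γ₂ Γ₃ Γ₄) (Set.Ioi 0) := by
  have hθ₁ := theta1_antitoneOn hN h₂ h₃ h₄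
  have hθ₃ := theta3_antitoneOn hN hγ h₁ h₂ h₃ h₄
  intro a ha a' ha' haa'
  rw [Set.mem_Ioi] at ha ha'
  have hN0 : (0 : ℝ) < N := by positivity
  refine max_le_max ?_ ?_
  · have := hθ₃ (Set.mem_Ioi.2 (by positivity : 0 < a / 3))
      (Set.mem_Ioi.2 (by positivity : 0 < a' / 3)) (by gcongr)
    unfold rho2
    omega
  · refine Nat.add_le_add_right (Nat.mul_le_mul_left 2 (max_le_max (max_le_max ?_ ?_) ?_)) 1
    · exact hθ₁ (Set.mem_Ioi.2 (by positivity)) (Set.mem_Ioi.2 (by positivity)) (by gcongr)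
    · exact hθ₃ (Set.mem_Ioi.2 (by positivity)) (Set.mem_Ioi.2 (by positivity)) (by gcongr)
    · exact h₁ (Set.mem_Ioi.2 (by positivity)) (Set.mem_Ioi.2 (by positivity)) (by gcongr)

theorem SigmaFun_monotone (N : ℕ) (γ : ℝ) (Γ₁ : ℝ → ℕ) {Γ₂ : ℕ → ℕ} (Γ₃ Γ₄ : ℝ → ℕ)
    (h₂ : Monotone Γ₂) (ε : ℝ) : Monotone (SigmaFun N γ Γ₁ Γ₂ Γ₃ Γ₄ ε) := fun _ _ hmn =>
  Nat.add_le_add_right (h₂ (Nat.add_le_add_right (max_le_max hmn le_rfl) _)) 1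

variable {T : H → H} {u p : H}

/-! ### Approximate fixed points and approximate projections -/

/-- Approximate fixed points of a nonexpansive map are stable under convex combinations. -/
theorem norm_sq_residual_convexComb_le (hT : ∀ a a', ‖T a - T a'‖ ≤ ‖a - a'‖) {v w : H}
    {η D t : ℝ} (ht : t ∈ Set.Icc (0 : ℝ) 1) (hv : ‖T v - v‖ ≤ η) (hw : ‖T w - w‖ ≤ η)
    (hD : ‖v - w‖ ≤ D) :
    ‖T ((1 - t) • v + t • w) - ((1 - t) • v + t • w)‖ ^ 2 ≤ D * η + η ^ 2 := by
  set z := (1 - t) • v + t • w with hz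
  obtain ⟨ht0, ht1⟩ := ht
  have hη : 0 ≤ η := (norm_nonneg _).trans hv
  have e1 : T z - z = (1 - t) • (T z - v) + t • (T z - w) := by
    rw [hz]
    module
  have ezv : ‖z - v‖ = t * ‖v - w‖ := by
    rw [show z - v = t • (w - v) by rw [hz]; module, norm_smul, Real.norm_of_nonneg ht0,
      norm_sub_rev]
  have ezw : ‖z - w‖ = (1 - t) * ‖v - w‖ := by
    rw [show z - w = (1 - t) • (v - w) by rw [hz]; module, norm_smul,
      Real.norm_of_nonneg (sub_nonneg.2 ht1)]
  have h1 : ‖T z - v‖ ≤ t * ‖v - w‖ + η := by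
    have := norm_sub_le_norm_sub_add_norm_sub (T z) (T v) v
    linarith [hT z v]
  have h2 : ‖T z - w‖ ≤ (1 - t) * ‖v - w‖ + η := by
    have := norm_sub_le_norm_sub_add_norm_sub (T z) (T w) w
    linarith [hT z w]
  rw [e1, norm_sub_mul_smul_add_sq, sub_sub_sub_cancel_left, norm_sub_rev w v]
  have h3 := mul_le_mul_of_nonneg_left (pow_le_pow_left₀ (norm_nonneg _) h1 2) (sub_nonneg.2 ht1)
  have h4 := mul_le_mul_of_nonneg_left (pow_le_pow_left₀ (norm_nonneg _) h2 2) ht0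
  have h5 := mul_le_mul_of_nonneg_right hD hη
  have h6 : 0 ≤ (1 - 2 * t) ^ 2 * (‖v - w‖ * η) := by positivity
  linarith

theorem continuous_of_nonexpansive {E : Type*} [NormedAddCommGroup E] {T : E → E}
    (hT : ∀ a a', ‖T a - T a'‖ ≤ ‖a - a'‖) : Continuous T :=
  (LipschitzWith.of_dist_le_mul (K := 1) fun a a' => by
    simpa [dist_eq_norm] using hT a a').continuous

theorem convex_fixedPoints_of_nonexpansive (hT : ∀ a a', ‖T a - T a'‖ ≤ ‖a - a'‖) :
    Convex ℝ (Function.fixedPoints T) := by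
  intro v hv w hw s t hs ht hst
  obtain rfl : s = 1 - t := by linarith
  have h := norm_sq_residual_convexComb_le (η := 0) hT ⟨ht, by linarith⟩
    (by rw [Function.mem_fixedPoints.1 hv]; simp) (by rw [Function.mem_fixedPoints.1 hw]; simp)
    (le_refl ‖v - w‖)
  have h0 : ‖T ((1 - t) • v + t • w) - ((1 - t) • v + t • w)‖ ^ 2 = 0 :=
    le_antisymm (by simpa using h) (sq_nonneg _)
  exact sub_eq_zero.1 (norm_eq_zero.1 (pow_eq_zero_iff two_ne_zero |>.1 h0))

theorem isMetricProjection_of_inner_le_zero {S : Set H} {q : H} (hq : q ∈ S)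
    (h : ∀ y ∈ S, inner ℝ (u - q) (y - q) ≤ 0) : IsMetricProjection S u q := by
  have key : ∀ y ∈ S, ‖u - q‖ ^ 2 + ‖y - q‖ ^ 2 ≤ ‖u - y‖ ^ 2 := fun y hy => by
    rw [← sub_sub_sub_cancel_right u y q, norm_sub_sq_real (u - q)]
    linarith [h y hy]
  refine ⟨hq, fun y hy => ?_, fun y hy hmin => ?_⟩
  · rw [dist_eq_norm, dist_eq_norm]
    refine abs_le_of_sq_le_sq' ?_ (norm_nonneg _) |>.2
    nlinarith [key y hy, sq_nonneg ‖y - q‖]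
  · have h1 := hmin q hq
    rw [dist_eq_norm, dist_eq_norm] at h1
    have h2 := pow_le_pow_left₀ (norm_nonneg _) h1 2
    have h3 : ‖y - q‖ ^ 2 = 0 := le_antisymm (by linarith [key y hy]) (sq_nonneg _)
    exact sub_eq_zero.1 (norm_eq_zero.1 (pow_eq_zero_iff two_ne_zero |>.1 h3))

theorem exists_inner_le_zero_of_isClosed_of_convex [CompleteSpace H] {S : Set H}
    (hne : S.Nonempty) (hcl : IsClosed S) (hconv : Convex ℝ S) (u : H) :
    ∃ q ∈ S, ∀ y ∈ S, inner ℝ (u - q) (y - q) ≤ 0 := by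
  obtain ⟨q, hq, hmin⟩ := exists_norm_eq_iInf_of_complete_convex hne hcl.isComplete hconv u
  exact ⟨q, hq, (norm_eq_iInf_iff_real_inner_le_zero hconv hq).1 hmin⟩

theorem mapsTo_min {N : ℝ} (hN : 1 ≤ N) {δ : ℝ → ℝ}
    (hδ : Set.MapsTo δ (Set.Ioc 0 1) (Set.Ioc 0 1)) :
    Set.MapsTo (fun ξ => min (δ (ξ ^ 2 / (24 * N))) (ξ ^ 2 / (24 * N)))
      (Set.Ioc 0 1) (Set.Ioc 0 1) := by
  rintro ξ ⟨hξ0, hξ1⟩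
  have h0 : 0 < ξ ^ 2 / (24 * N) := by positivity
  have h1 : ξ ^ 2 / (24 * N) ≤ 1 := by
    rw [div_le_one (by positivity)]
    nlinarith
  exact ⟨lt_min (hδ ⟨h0, h1⟩).1 h0, (min_le_right _ _).trans h1⟩

theorem phi_pos (N : ℕ) (ε : ℝ) {δ : ℝ → ℝ} (hδ : Set.MapsTo δ (Set.Ioc 0 1) (Set.Ioc 0 1)) :
    0 < phi N ε δ := by
  unfold phi
  rw [Finset.lt_inf'_iff]
  exact fun i _ => (hδ.iterate i (by simp : (1 : ℝ) ∈ Set.Ioc (0 : ℝ) 1)).1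

/-- Approximate projection: some approximate fixed point `z ∈ B` is nearly as close to `u` as every
`η`-fixed point in `B`, where the quality `δ η` of `z` may depend on `η` and `η ≥ φ(ε, δ)`.
Otherwise, from `z = p` on, each iterate `δ^[i] 1` in decreasing order of `i` would supply a point
nearer to `u` by `ε` in squared distance, and there are too many iterates for that. -/
theorem exists_approx_nearest {E : Type*} [NormedAddCommGroup E] {T : E → E} {u p : E}
    (hp : T p = p) {N : ℕ} (hu : 2 * ‖u - p‖ ≤ N) {B : Set E} (hpB : p ∈ B) {ε : ℝ}
    (hε : 0 < ε) {δ : ℝ → ℝ}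
    (hδ : Set.MapsTo δ (Set.Ioc 0 1) (Set.Ioc 0 1)) :
    ∃ η ∈ Set.Ioc (0 : ℝ) 1, phi N ε δ ≤ η ∧ ∃ z ∈ B, ‖T z - z‖ ≤ δ η ∧
      ∀ y ∈ B, ‖T y - y‖ ≤ η → ‖u - z‖ ^ 2 ≤ ‖u - y‖ ^ 2 + ε := by
  by_contra! hcon
  set r := ⌈(N : ℝ) ^ 2 / (4 * ε)⌉₊ with hr
  have hmem : ∀ i, δ^[i] 1 ∈ Set.Ioc (0 : ℝ) 1 := fun i => hδ.iterate i (by simp)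
  have hdesc : ∀ k ≤ r + 1, ∃ z ∈ B, ‖T z - z‖ ≤ δ^[r + 1 - k] 1 ∧
      ‖u - z‖ ^ 2 ≤ (N : ℝ) ^ 2 / 4 - k * ε := by
    intro k hk
    induction k with
    | zero =>
      refine ⟨p, hpB, ?_, ?_⟩
      · simpa [hp] using (hmem (r + 1)).1.le
      · simp only [Nat.cast_zero, zero_mul, sub_zero]
        nlinarith [norm_nonneg (u - p)]
    | succ k ih =>
      obtain ⟨z, hzB, hz, hzu⟩ := ih (by omega)
      rw [show r + 1 - k = r - k + 1 by omega, Function.iterate_succ_apply'] at hz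
      obtain ⟨y, hyB, hy, hyu⟩ := hcon (δ^[r - k] 1) (hmem _)
        (Finset.inf'_le _ (Finset.mem_range.2 (by omega))) z hzB hz
      refine ⟨y, hyB, by rwa [Nat.add_sub_add_right], ?_⟩
      push_cast
      linarith
  obtain ⟨z, -, -, hz⟩ := hdesc (r + 1) le_rfl
  have h1 : (N : ℝ) ^ 2 / (4 * ε) ≤ r := Nat.le_ceil _
  rw [div_le_iff₀ (by positivity)] at h1
  push_cast at hz
  nlinarith [sq_nonneg ‖u - z‖]

theorem Phi_pos {N : ℕ} (hN : N ≠ 0) (ε : ℝ) {δ : ℝ → ℝ}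
    (hδ : Set.MapsTo δ (Set.Ioc 0 1) (Set.Ioc 0 1)) : 0 < Phi N ε δ := by
  have hN1 : (1 : ℝ) ≤ N := by exact_mod_cast Nat.one_le_iff_ne_zero.2 hN
  have := phi_pos N (ε ^ 2 / (4 * N ^ 2)) (mapsTo_min hN1 hδ)
  unfold Phi
  positivity

/-- Variational form of the approximate projection. A convex combination of `z` and an `η`-fixed
point `y` is still an approximate fixed point, so near-minimality of `z` can be tested along the
segment from `z` to `y`. -/
theorem exists_approx_variational (hT : ∀ a a', ‖T a - T a'‖ ≤ ‖a - a'‖) (hp : T p = p) {N : ℕ}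
    (hN : N ≠ 0) (hu : 2 * ‖u - p‖ ≤ N) {ε : ℝ} (hε : 0 < ε) {δ : ℝ → ℝ}
    (hδ : Set.MapsTo δ (Set.Ioc 0 1) (Set.Ioc 0 1)) :
    ∃ η > 0, Phi N ε δ ≤ η ∧ ∃ z, ‖z - p‖ ≤ N ∧ ‖T z - z‖ ≤ δ η ∧
      ∀ y, ‖y - p‖ ≤ N → ‖T y - y‖ ≤ η → inner ℝ (u - z) (y - z) ≤ ε := by
  have hN1 : (1 : ℝ) ≤ N := by exact_mod_cast Nat.one_le_iff_ne_zero.2 hN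
  have hδ' := mapsTo_min hN1 hδ
  obtain ⟨ξ, ⟨hξ0, hξ1⟩, hφ, z, hzB, hz, hmin⟩ := exists_approx_nearest (B := {y | ‖y - p‖ ≤ N})
    hp hu (by simp) (by positivity : 0 < ε ^ 2 / (4 * (N : ℝ) ^ 2)) hδ'
  have hη : 0 < ξ ^ 2 / (24 * N) := by positivity
  refine ⟨ξ ^ 2 / (24 * N), hη, ?_, z, hzB, hz.trans (min_le_left _ _), fun y hy hyη => ?_⟩
  · have := (phi_pos N (ε ^ 2 / (4 * N ^ 2)) hδ').le
    unfold Phi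
    gcongr
  have hzB' : ‖z - p‖ ≤ N := hzB
  have hzy : ‖z - y‖ ≤ 2 * N := by
    have := norm_sub_le_norm_sub_add_norm_sub z p y
    rw [norm_sub_rev p] at this
    linarith
  rcases le_or_gt ε (4 * (N : ℝ) ^ 2) with hεN | hεN
  · -- This `t` minimizes the bound `2 t N² + ε² / (8 N² t)` on the inner product.
    set t := ε / (4 * (N : ℝ) ^ 2) with ht
    have ht0 : 0 < t := by positivity
    have ht1 : t ≤ 1 := (div_le_one (by positivity)).2 hεN
    have hres := norm_sq_residual_convexComb_le hT ⟨ht0.le, ht1⟩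
      (hz.trans (min_le_right _ _)) hyη hzy
    have hξ : 2 * N * (ξ ^ 2 / (24 * N)) + (ξ ^ 2 / (24 * N)) ^ 2 ≤ ξ ^ 2 := by
      have h1 : 2 * N * (ξ ^ 2 / (24 * N)) = ξ ^ 2 / 12 := by
        field_simp
        norm_num
      have h2 : ξ ^ 2 / (24 * N) ≤ ξ ^ 2 / 24 := by
        gcongr
        linarith
      have h3 : (ξ ^ 2 / (24 * N)) ^ 2 ≤ (ξ ^ 2 / 24) ^ 2 := by gcongr
      nlinarith [pow_le_one₀ hξ0.le hξ1 (n := 2), sq_nonneg ξ]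
    have hB : ‖(1 - t) • z + t • y - p‖ ≤ N := by
      rw [show (1 - t) • z + t • y - p = (1 - t) • (z - p) + t • (y - p) by module]
      exact norm_one_sub_smul_add_le ⟨ht0.le, ht1⟩ hzB' hy
    have hnear := hmin _ hB (abs_le_of_sq_le_sq' (hres.trans hξ) hξ0.le).2
    rw [show u - ((1 - t) • z + t • y) = (u - z) - t • (y - z) by module,
      norm_sub_sq_real (u - z), real_inner_smul_right, norm_smul, mul_pow, Real.norm_eq_abs,
      sq_abs, norm_sub_rev y z] at hnear
    have h1 : t ^ 2 * ‖z - y‖ ^ 2 ≤ t ^ 2 * (2 * N) ^ 2 := by gcongr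
    have h2 : t * (4 * (N : ℝ) ^ 2) = ε := by
      rw [ht]
      field_simp
    have h3 : ε ^ 2 / (4 * (N : ℝ) ^ 2) = t * ε := by
      rw [ht]
      ring
    refine le_of_mul_le_mul_left ?_ ht0
    nlinarith
  · have h1 := real_inner_le_norm (u - z) (y - z)
    have h2 := norm_sub_le_norm_sub_add_norm_sub u p z
    rw [norm_sub_rev p z] at h2
    rw [norm_sub_rev y z] at h1
    nlinarith [norm_nonneg (z - y), norm_nonneg (u - z)]

/-! ### Metastability and convergence of the iteration -/

namespace IsHalpernMann

variable {α b : ℕ → ℝ} {x : ℕ → H}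

theorem norm_sq_even_sub_le (h : IsHalpernMann T u α b x) {z : H} {d : ℝ} (hz : ‖T z - z‖ ≤ d)
    (n : ℕ) : ‖x (2 * n + 2) - z‖ ^ 2 ≤ (1 - α n) * ‖x (2 * n) - z‖ ^ 2 +
      α n * (2 * inner ℝ (u - z) (x (2 * n + 1) - z)) +
        (2 * ‖x (2 * n + 1) - z‖ * d + d ^ 2) := by
  obtain ⟨ha0, ha1⟩ := h.anchor_mem n
  have hd : 0 ≤ d := (norm_nonneg _).trans hz
  have h1 : ‖x (2 * n + 2) - z‖ ≤ ‖x (2 * n + 1) - z‖ + d := by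
    rw [h.even_sub]
    refine norm_one_sub_smul_add_le (h.relax_mem n) (by linarith) ?_
    have := norm_sub_le_norm_sub_add_norm_sub (T (x (2 * n + 1))) (T z) z
    linarith [h.nonexpansive (x (2 * n + 1)) z]
  have h2 := pow_le_pow_left₀ (norm_nonneg _) h1 2
  have h3 : ‖x (2 * n + 1) - z‖ ^ 2 ≤ (1 - α n) * ‖x (2 * n) - z‖ ^ 2 +
      α n * (2 * inner ℝ (u - z) (x (2 * n + 1) - z)) := by
    -- `‖v‖² ≤ ‖v - w‖² + 2⟪w, v⟫` with `w = α (u - z)`, followed by `(1 - α)² ≤ 1 - α`.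
    have e : (1 - α n) • (x (2 * n) - z) = (x (2 * n + 1) - z) - α n • (u - z) := by
      rw [h.odd_sub]
      abel
    have h4 := congrArg (fun v => ‖v‖ ^ 2) e
    simp only [norm_smul, mul_pow, Real.norm_eq_abs, sq_abs] at h4
    rw [norm_sub_sq_real (x (2 * n + 1) - z), real_inner_smul_right, real_inner_comm] at h4
    have h5 : (1 - α n) ^ 2 * ‖x (2 * n) - z‖ ^ 2 ≤ (1 - α n) * ‖x (2 * n) - z‖ ^ 2 := by
      gcongr
      nlinarith
    linarith [sq_nonneg ‖α n • (u - z)‖]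
  linarith

/-- An approximate fixed point `z` at which the variational inequality holds approximately along
the iteration attracts the even iterates; the residual of `z` costs a term growing linearly
in `n`. -/
theorem norm_sq_even_sub_le_of_inner_le (h : IsHalpernMann T u α b x) (hp : T p = p) {N : ℕ}
    (hN : N ≠ 0) (hx : ‖x 0 - p‖ ≤ N) (hu : 2 * ‖u - p‖ ≤ N) {Γ₂ : ℕ → ℕ}
    (hΓ₂ : IsRateOfDivergenceOfSum α Γ₂) {z : H} (hzp : ‖z - p‖ ≤ N) {d : ℝ} (hd : d ≤ 1)
    (hz : ‖T z - z‖ ≤ d) {e : ℝ} (he : 0 < e) {K : ℕ}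
    (hK : ∀ m, K ≤ m → inner ℝ (u - z) (x m - z) ≤ e / 24) {n : ℕ}
    (hn : sigmaRate Γ₂ (4 * N ^ 2) e K ≤ n) :
    ‖x (2 * n) - z‖ ^ 2 ≤ e / 3 + e / 12 + n * (5 * N * d) := by
  have hN1 : (1 : ℝ) ≤ N := by exact_mod_cast Nat.one_le_iff_ne_zero.2 hN
  have hd0 : 0 ≤ d := (norm_nonneg _).trans hz
  have hbd : ∀ m, ‖x m - z‖ ≤ 2 * N := fun m => by
    have h1 := norm_sub_le_norm_sub_add_norm_sub (x m) p z
    have h2 := h.norm_sub_fixedPoint_le hp hx (by linarith [norm_nonneg (u - p)]) m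
    rw [norm_sub_rev p z] at h1
    linarith
  have key := le_of_weighted_recursion (a := α) (s := fun n => ‖x (2 * n) - z‖ ^ 2)
    (c := fun _ => 5 * N * d) (r := e / 12) (D := 4 * N ^ 2) (e := e / 3) (K := K) (n := n)
    h.anchor_mem hΓ₂ (by positivity) (by positivity) (by positivity) (fun _ => by positivity)
    (sq_nonneg _) ?_ ?_ ?_
  · simp only [Finset.sum_const, Nat.card_Ico, nsmul_eq_mul] at key
    have hle : ((n - K : ℕ) : ℝ) * (5 * N * d) ≤ n * (5 * N * d) := by
      gcongr
      omega
    linarith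
  · nlinarith [hbd (2 * K), norm_nonneg (x (2 * K) - z)]
  · unfold sigmaRate at hn
    push_cast at hn
    rwa [show 3 * (4 * (N : ℝ) ^ 2) / e = 4 * N ^ 2 / (e / 3) by field_simp] at hn
  · intro i hi _
    have h1 := h.norm_sq_even_sub_le hz i
    have h2 := mul_le_mul_of_nonneg_left (hK (2 * i + 1) (by omega)) (h.anchor_mem i).1
    have h3 := mul_le_mul_of_nonneg_right (hbd (2 * i + 1)) hd0
    have h4 : d ^ 2 ≤ N * d := by nlinarith
    simp only [mul_add, mul_one]
    linarith

/-- The rate of metastability of the alternating Halpern–Mann iteration. All iterates in the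
interval lie within `ε / 2` of one approximate projection. -/
theorem isRateOfMetastability_mu (h : IsHalpernMann T u α b x) (hp : T p = p) {N : ℕ}
    (hN : N ≠ 0) (hx : ‖x 0 - p‖ ≤ N) (hu : 2 * ‖u - p‖ ≤ N) {γ : ℝ} (hγ : 0 < γ)
    (hb : ∀ n, γ ≤ b n ∧ b n ≤ 1 - γ) {Γ₁ : ℝ → ℕ} {Γ₂ : ℕ → ℕ} {Γ₃ Γ₄ : ℝ → ℕ}
    (hΓ₁ : IsRateOfConvergenceToZero α Γ₁) (hΓ₂ : IsRateOfDivergenceOfSum α Γ₂)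
    (hΓ₃ : IsCauchyRateOfSum (fun n => |α (n + 1) - α n|) Γ₃)
    (hΓ₄ : IsCauchyRateOfSum (fun n => |b (n + 1) - b n|) Γ₄)
    (h₁ : AntitoneOn Γ₁ (Set.Ioi 0)) (h₂ : Monotone Γ₂)
    (h₃ : AntitoneOn Γ₃ (Set.Ioi 0)) (h₄ : AntitoneOn Γ₄ (Set.Ioi 0)) :
    IsRateOfMetastability x (mu N γ Γ₁ Γ₂ Γ₃ Γ₄) := by
  intro ε hε f
  have hN1 : (1 : ℝ) ≤ N := by exact_mod_cast Nat.one_le_iff_ne_zero.2 hN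
  set Δ := DeltaFun N γ Γ₁ Γ₂ Γ₃ Γ₄ ε f
  set P := PFun N γ Γ₁ Γ₂ Γ₃ Γ₄ ε f
  set S := SigmaFun N γ Γ₁ Γ₂ Γ₃ Γ₄ ε
  set ρ := rho N γ Γ₁ Γ₂ Γ₃ Γ₄
  set θ := theta4 N γ Γ₁ Γ₂ Γ₃ Γ₄ (ε / 4)
  have hΔ : ∀ n, Δ n ∈ Set.Ioc (0 : ℝ) 1 := fun n =>
    ⟨lt_min (by positivity) one_pos, min_le_right _ _⟩
  have hΔρ : Set.MapsTo (fun η => Δ (ρ η)) (Set.Ioc 0 1) (Set.Ioc 0 1) := fun η _ => hΔ _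
  obtain ⟨η, hη, hΦ, z, hzp, hz, hvar⟩ := exists_approx_variational h.nonexpansive hp hN hu
    (by positivity : 0 < ε ^ 2 / 16 / 24) hΔρ
  have hn₀ : ρ η ≤ Psi N ρ (ε ^ 2 / 16 / 24) Δ :=
    rho_antitoneOn hN hγ h₁ h₂ h₃ h₄ (Set.mem_Ioi.2 (Phi_pos hN _ hΔρ)) hη hΦ
  refine ⟨2 * max (S (ρ η)) θ + 1, ?_, ?_⟩
  · have := SigmaFun_monotone N γ Γ₁ Γ₃ Γ₄ h₂ ε hn₀
    exact Nat.add_le_add_right (Nat.mul_le_mul_left 2 (max_le_max this le_rfl)) 1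
  change ∀ i ∈ Set.Icc (2 * max (S (ρ η)) θ + 1) (P (ρ η)),
    ∀ j ∈ Set.Icc (2 * max (S (ρ η)) θ + 1) (P (ρ η)), dist (x i) (x j) ≤ ε
  have heven : ∀ m, S (ρ η) ≤ m → m ≤ P (ρ η) → ‖x (2 * m) - z‖ ≤ ε / 4 := fun m hm hmP => by
    have h5 := h.norm_sq_even_sub_le_of_inner_le hp hN hx hu hΓ₂ hzp (hΔ (ρ η)).2 hz
      (by positivity : 0 < ε ^ 2 / 16)
      (fun k hk => hvar (x k) (h.norm_sub_fixedPoint_le hp hx (by linarith [norm_nonneg (u - p)]) k)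
        (h.norm_residual_le_of_rho_le hp hN hx hu hγ hb hΓ₁ hΓ₂ hΓ₃ hΓ₄ hη
          ((le_max_left _ _).trans hk))) hm
    have h6 : Δ (ρ η) ≤ ε ^ 2 / 16 / (30 * N * ((P (ρ η) : ℝ) + 1)) := min_le_left _ _
    rw [le_div_iff₀ (by positivity)] at h6
    have h7 : m * (5 * N * Δ (ρ η)) ≤ ((P (ρ η) : ℝ) + 1) * (5 * N * Δ (ρ η)) := by
      have := (hΔ (ρ η)).1.le
      have : (m : ℝ) ≤ P (ρ η) := by exact_mod_cast hmP
      gcongr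
      linarith
    refine abs_le_of_sq_le_sq' ?_ (by positivity) |>.2
    nlinarith
  have hall : ∀ i ∈ Set.Icc (2 * max (S (ρ η)) θ + 1) (P (ρ η)), ‖x i - z‖ ≤ ε / 2 := by
    rintro i ⟨hi, hiP⟩
    have hmax1 := le_max_left (S (ρ η)) θ
    have hmax2 := le_max_right (S (ρ η)) θ
    obtain ⟨k, rfl | rfl⟩ := Nat.even_or_odd' i
    · linarith [heven k (by omega) (by omega)]
    · have h5 := heven k (by omega) (by omega)
      have h6 := h.norm_odd_sub_even_le_of_theta4_le hp hN hx hu hγ hb hΓ₁ hΓ₂ hΓ₃ hΓ₄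
        (by positivity : 0 < ε / 4) (show θ ≤ k by omega)
      have h7 := norm_sub_le_norm_sub_add_norm_sub (x (2 * k + 1)) (x (2 * k)) z
      linarith
  intro i hi j hj
  have := dist_triangle_right (x i) (x j) z
  rw [dist_eq_norm (x i) z, dist_eq_norm (x j) z] at this
  linarith [hall i hi, hall j hj]

end IsHalpernMann

theorem IsRateOfMetastability.cauchySeq {X : Type*} [MetricSpace X] {x : ℕ → X}
    {M : ℝ → (ℕ → ℕ) → ℕ} (hM : IsRateOfMetastability x M) : CauchySeq x := by
  rw [Metric.cauchySeq_iff']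
  by_contra! hcon
  obtain ⟨ε, hε, hcon⟩ := hcon
  choose f hf hfε using hcon
  obtain ⟨n, -, hn⟩ := hM (ε / 2) (half_pos hε) f
  have := hn (f n) ⟨hf n, le_rfl⟩ n ⟨le_rfl, hf n⟩
  linarith [hfε n]

/-- A convergent alternating Halpern–Mann iteration with vanishing residual tends to the point of
`Fix T` singled out by the variational inequality: its limit satisfies that inequality, which makes
the nearest point attract the iterates. -/
theorem IsHalpernMann.eq_of_tendsto {α b : ℕ → ℝ} {x : ℕ → H} (h : IsHalpernMann T u α b x)
    (hp : T p = p) {N : ℕ} (hN : N ≠ 0) (hx : ‖x 0 - p‖ ≤ N) (hu : 2 * ‖u - p‖ ≤ N)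
    {Γ₂ : ℕ → ℕ} (hΓ₂ : IsRateOfDivergenceOfSum α Γ₂) {q : H} (hq : T q = q)
    (hvar : ∀ y, T y = y → inner ℝ (u - q) (y - q) ≤ 0) {l : H} (hl : Tendsto x atTop (𝓝 l))
    (hTl : T l = l) : l = q := by
  have huq : ‖u - q‖ ≤ ‖u - p‖ := by
    have := (isMetricProjection_of_inner_le_zero (S := Function.fixedPoints T) hq hvar).2.1 p hp
    rwa [dist_eq_norm, dist_eq_norm] at this
  have hqp : ‖q - p‖ ≤ N := by
    have := norm_sub_le_norm_sub_add_norm_sub q u p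
    rw [norm_sub_rev q u] at this
    linarith
  have hsq : ‖l - q‖ ^ 2 ≤ 0 := by
    refine le_of_forall_pos_le_add fun e he => ?_
    have hinner : Tendsto (fun m => inner ℝ (u - q) (x m - q)) atTop
        (𝓝 (inner ℝ (u - q) (l - q))) := tendsto_const_nhds.inner (hl.sub_const q)
    obtain ⟨K, hK⟩ := eventually_atTop.1 (hinner.eventually_lt_const
      (show inner ℝ (u - q) (l - q) < e / 24 from (hvar l hTl).trans_lt (by positivity)))
    have heven : Tendsto (fun n => ‖x (2 * n) - q‖ ^ 2) atTop (𝓝 (‖l - q‖ ^ 2)) :=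
      ((hl.comp (tendsto_id.const_mul_atTop' two_pos)).sub_const q).norm.pow 2
    refine le_of_tendsto heven (eventually_atTop.2
      ⟨sigmaRate Γ₂ (4 * N ^ 2) e K, fun n hn => ?_⟩)
    have := h.norm_sq_even_sub_le_of_inner_le hp hN hx hu hΓ₂ hqp zero_le_one
      (by rw [hq]; simp) he (fun m hm => (hK m hm).le) hn
    linarith
  exact sub_eq_zero.1 (norm_eq_zero.1 (pow_eq_zero_iff two_ne_zero |>.1
    (le_antisymm hsq (sq_nonneg _))))

/-- Strong convergence of the alternating Halpern–Mann iteration to the metric projection of the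
anchor onto the fixed points. -/
theorem IsHalpernMann.exists_tendsto_isMetricProjection [CompleteSpace H] {α b : ℕ → ℝ}
    {x : ℕ → H} (h : IsHalpernMann T u α b x) (hp : T p = p) {N : ℕ}
    (hN : N ≠ 0) (hx : ‖x 0 - p‖ ≤ N) (hu : 2 * ‖u - p‖ ≤ N) {γ : ℝ} (hγ : 0 < γ)
    (hb : ∀ n, γ ≤ b n ∧ b n ≤ 1 - γ) {Γ₁ : ℝ → ℕ} {Γ₂ : ℕ → ℕ} {Γ₃ Γ₄ : ℝ → ℕ}
    (hΓ₁ : IsRateOfConvergenceToZero α Γ₁) (hΓ₂ : IsRateOfDivergenceOfSum α Γ₂)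
    (hΓ₃ : IsCauchyRateOfSum (fun n => |α (n + 1) - α n|) Γ₃)
    (hΓ₄ : IsCauchyRateOfSum (fun n => |b (n + 1) - b n|) Γ₄) (hcauchy : CauchySeq x) :
    ∃ q, IsMetricProjection (Function.fixedPoints T) u q ∧ Tendsto x atTop (𝓝 q) := by
  have hc : Continuous T := continuous_of_nonexpansive h.nonexpansive
  obtain ⟨q, hq, hvar⟩ := exists_inner_le_zero_of_isClosed_of_convex
    (S := Function.fixedPoints T) ⟨p, hp⟩ (isClosed_eq hc continuous_id)
    (convex_fixedPoints_of_nonexpansive h.nonexpansive) u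
  obtain ⟨l, hl⟩ := cauchySeq_tendsto_of_complete hcauchy
  have hTl : T l = l := by
    have hres : ‖T l - l‖ ≤ 0 := by
      refine le_of_forall_pos_le_add fun ε hε => ?_
      rw [zero_add]
      exact le_of_tendsto (((hc.tendsto l).comp hl).sub hl).norm (eventually_atTop.2 ⟨_, fun m hm =>
        h.norm_residual_le_of_rho_le hp hN hx hu hγ hb hΓ₁ hΓ₂ hΓ₃ hΓ₄ hε hm⟩)
    exact sub_eq_zero.1 (norm_le_zero_iff.1 hres)
  refine ⟨q, isMetricProjection_of_inner_le_zero hq hvar, ?_⟩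
  rwa [← h.eq_of_tendsto hp hN hx hu hΓ₂ hq hvar hl hTl]

/-! ### The Douglas–Rachford iteration -/

/-- A sequence whose oscillation is dominated by that of the odd terms of `x` inherits its rate of
metastability, evaluated at the counterfunction `2 f + 1`. -/
theorem IsRateOfMetastability.of_odd {X : Type*} [MetricSpace X] {x w : ℕ → X}
    {M : ℝ → (ℕ → ℕ) → ℕ} (hM : IsRateOfMetastability x M)
    (hw : ∀ i j, dist (w i) (w j) ≤ dist (x (2 * i + 1)) (x (2 * j + 1))) :
    IsRateOfMetastability w fun ε f => M ε fun n => 2 * f n + 1 := by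
  intro ε hε f
  obtain ⟨n, hn, hosc⟩ := hM ε hε fun n => 2 * f n + 1
  refine ⟨n, hn, ?_⟩
  rintro i ⟨hi, hif⟩ j ⟨hj, hjf⟩
  exact (hw i j).trans (hosc _ ⟨by omega, by omega⟩ _ ⟨by omega, by omega⟩)

end DouglasRachford

theorem mainTheorem5 {H : Type*} [NormedAddCommGroup H] [InnerProductSpace ℝ H] [CompleteSpace H]
    (U₁ U₂ : H → Set H)
    (hU₁ : DouglasRachford.IsMaximalMonotoneOperator U₁)
    (hU₂ : DouglasRachford.IsMaximalMonotoneOperator U₂)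
    (c : ℝ) (hc : 0 < c)
    (α β : ℕ → ℝ)
    (hα : ∀ n, α n ∈ Set.Icc (0 : ℝ) 1)
    (hβ : ∀ n, β n ∈ Set.Icc (-1 : ℝ) 1)
    (Γ₁ : ℝ → ℕ) (Γ₂ : ℕ → ℕ) (Γ₃ Γ₄ : ℝ → ℕ)
    (hΓ₁ : DouglasRachford.IsRateOfConvergenceToZero α Γ₁)
    (hΓ₂ : DouglasRachford.IsRateOfDivergenceOfSum α Γ₂)
    (hΓ₃ : DouglasRachford.IsCauchyRateOfSum (fun n => |α (n + 1) - α n|) Γ₃)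
    (hΓ₄ : DouglasRachford.IsCauchyRateOfSum (fun n => |β (n + 1) - β n|) Γ₄)
    (hmono₁ : AntitoneOn Γ₁ (Set.Ioi 0))
    (hmono₂ : Monotone Γ₂)
    (hmono₃ : AntitoneOn Γ₃ (Set.Ioi 0))
    (hmono₄ : AntitoneOn Γ₄ (Set.Ioi 0))
    (u : H) (x y z : ℕ → H)
    (hodd : ∀ n, x (2 * n + 1) = (1 - α n) • x (2 * n) + α n • u)
    (hy : ∀ n, y n =
      DouglasRachford.resolvent (DouglasRachford.scale c U₂) (x (2 * n + 1)))
    (hz : ∀ n, z n =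
      DouglasRachford.resolvent (DouglasRachford.scale c U₁) ((2 : ℝ) • y n - x (2 * n + 1)))
    (heven : ∀ n, x (2 * n + 2) = x (2 * n + 1) + (1 - β n) • (z n - y n))
    (N : ℕ) (hN : N ≠ 0)
    (hp : ∃ p ∈ Function.fixedPoints
        (DouglasRachford.reflectedResolvent (DouglasRachford.scale c U₁) ∘
          DouglasRachford.reflectedResolvent (DouglasRachford.scale c U₂)),
      ‖x 0 - p‖ ≤ N ∧ 2 * ‖u - p‖ ≤ N)
    (γ : ℝ) (hγ : γ ∈ Set.Ioc (0 : ℝ) 1)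
    (hβγ : ∀ n, -1 + γ ≤ β n ∧ β n ≤ 1 - γ) :
    ∃ xbar : H,
      DouglasRachford.IsMetricProjection
        (Function.fixedPoints
          (DouglasRachford.reflectedResolvent (DouglasRachford.scale c U₁) ∘
            DouglasRachford.reflectedResolvent (DouglasRachford.scale c U₂))) u xbar ∧
      Tendsto x atTop (𝓝 xbar) ∧
      DouglasRachford.IsRateOfMetastability x (DouglasRachford.mu3 N γ Γ₁ Γ₂ Γ₃ Γ₄) ∧
      Tendsto y atTop (𝓝 (DouglasRachford.resolvent (DouglasRachford.scale c U₂) xbar)) ∧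
      Tendsto z atTop (𝓝 (DouglasRachford.resolvent (DouglasRachford.scale c U₂) xbar)) ∧
      DouglasRachford.resolvent (DouglasRachford.scale c U₂) xbar ∈
        DouglasRachford.zer (DouglasRachford.sum U₁ U₂) ∧
      DouglasRachford.IsRateOfMetastability y
        (fun ε f => DouglasRachford.mu3 N γ Γ₁ Γ₂ Γ₃ Γ₄ ε (fun n => 2 * f n + 1)) ∧
      DouglasRachford.IsRateOfMetastability z
        (fun ε f => DouglasRachford.mu3 N γ Γ₁ Γ₂ Γ₃ Γ₄ (ε / 3) (fun n => 2 * f n + 1)) := by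
  have hA := hU₁.scale hc
  have hB := hU₂.scale hc
  set A := DouglasRachford.scale c U₁
  set B := DouglasRachford.scale c U₂
  set T := DouglasRachford.reflectedResolvent A ∘ DouglasRachford.reflectedResolvent B
  obtain ⟨p, hp, hx, hu⟩ := hp
  have hTp : T p = p := hp
  have hT : ∀ a a', ‖T a - T a'‖ ≤ ‖a - a'‖ := fun a a' =>
    (hA.norm_reflectedResolvent_sub_le _ _).trans (hB.norm_reflectedResolvent_sub_le _ _)
  have hz' : ∀ n, z n = DouglasRachford.resolvent A
      (DouglasRachford.reflectedResolvent B (x (2 * n + 1))) := fun n => by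
    rw [hz, hy, DouglasRachford.reflectedResolvent]
  -- Since `T v = v + 2 (z - y)`, the last step is a Mann step with weight `(1 - β n) / 2`.
  have h : DouglasRachford.IsHalpernMann T u α (fun n => (1 - β n) / 2) x := by
    refine ⟨hT, hα, fun n => ?_, hodd, fun n => ?_⟩
    · obtain ⟨h1, h2⟩ := hβ n
      constructor <;> linarith
    · have e : T (x (2 * n + 1)) = (2 : ℝ) • z n - ((2 : ℝ) • y n - x (2 * n + 1)) := by
        rw [hz, hy]
        rfl
      rw [heven, e]
      module
  have hb : ∀ n, γ / 2 ≤ (1 - β n) / 2 ∧ (1 - β n) / 2 ≤ 1 - γ / 2 := fun n => by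
    obtain ⟨h1, h2⟩ := hβγ n
    constructor <;> linarith
  have hΓ₄' : DouglasRachford.IsCauchyRateOfSum
      (fun n => |(1 - β (n + 1)) / 2 - (1 - β n) / 2|) Γ₄ := fun ε hε n => by
    refine (Finset.sum_le_sum fun i _ => ?_).trans (hΓ₄ ε hε n)
    rw [show (1 - β (i + 1)) / 2 - (1 - β i) / 2 = -(β (i + 1) - β i) / 2 by ring, abs_div,
      abs_neg, abs_two]
    linarith [abs_nonneg (β (i + 1) - β i)]
  have hγ2 : 0 < γ / 2 := half_pos hγ.1
  have hmeta : DouglasRachford.IsRateOfMetastability x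
      (DouglasRachford.mu3 N γ Γ₁ Γ₂ Γ₃ Γ₄) :=
    h.isRateOfMetastability_mu hTp hN hx hu hγ2 hb hΓ₁ hΓ₂ hΓ₃ hΓ₄' hmono₁ hmono₂ hmono₃ hmono₄
  obtain ⟨q, hq, hlim⟩ := h.exists_tendsto_isMetricProjection hTp hN hx hu hγ2 hb hΓ₁ hΓ₂ hΓ₃
    hΓ₄' hmeta.cauchySeq
  have hoddlim : Tendsto (fun n => x (2 * n + 1)) atTop (𝓝 q) :=
    hlim.comp (tendsto_atTop_mono (fun n => by simp only [id]; omega) tendsto_id)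
  have hyz : ∀ S : H → H, (∀ a a', ‖S a - S a'‖ ≤ ‖a - a'‖) →
      Tendsto (fun n => S (x (2 * n + 1))) atTop (𝓝 (S q)) := fun S hS =>
    ((DouglasRachford.continuous_of_nonexpansive hS).tendsto q).comp hoddlim
  have hS : ∀ a a', ‖DouglasRachford.resolvent A (DouglasRachford.reflectedResolvent B a) -
      DouglasRachford.resolvent A (DouglasRachford.reflectedResolvent B a')‖ ≤ ‖a - a'‖ :=
    fun a a' => (hA.norm_resolvent_sub_le _ _).trans (hB.norm_reflectedResolvent_sub_le _ _)
  refine ⟨q, hq, hlim, hmeta, ?_, ?_, DouglasRachford.resolvent_mem_zer_sum hU₁ hU₂ hc hq.1,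
    hmeta.of_odd fun i j => ?_, fun ε hε f => ?_⟩
  · simpa only [← hy] using hyz _ hB.norm_resolvent_sub_le
  · have := hyz _ hS
    rw [DouglasRachford.resolvent_reflectedResolvent_eq hq.1] at this
    simpa only [← hz'] using this
  · rw [hy, hy, dist_eq_norm, dist_eq_norm]
    exact hB.norm_resolvent_sub_le _ _
  · have hzmeta := hmeta.of_odd (w := z) fun i j => by
      rw [hz', hz', dist_eq_norm, dist_eq_norm]
      exact hS _ _
    obtain ⟨n, hn, hosc⟩ := hzmeta (ε / 3) (by positivity) f
    exact ⟨n, hn, fun i hi j hj => (hosc i hi j hj).trans (by linarith)⟩
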